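/- Let $n,m,q\ge 0$ be integers, let $\epsilon_1,\dots,\epsilon_n$ be independent random vectors on a probability space with $\epsilon_i\sim N(0,I_m)$, let $b_1,\dots,b_n\in\mathbb R^q$ be fixed vectors, and let $A\in\mathbb R^{q\times m}$ be a fixed matrix. Put $$Z=\sum_{i=1}^n A\epsilon_i b_i^T\in\mathbb R^{q\times q},\qquad L=\max\Big(\mathrm{Tr}(A^TA)\,\Big\|\sum_{i=1}^n b_ib_i^T\Big\|,\ \Big(\sum_{i=1}^n\|b_i\|^2\Big)\,\|AA^T\|\Big),$$ where $\|\cdot\|$ denotes the spectral norm (largest singular value) of a matrix and the Euclidean norm of a vector. If $L>0$, then for every real $t\ge 0$ $$\Pr\big[\|Z\|\ge t\big]\le \max(m,q)\,\exp\Big(-\frac{t^2}{2L}\Big).$$ In the degenerate case $L=0$ one has $Z=0$ almost surely (so $\Pr[\|Z\|\ge t]=0$ for every $t>0$). -/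

import Mathlib

open MeasureTheory ProbabilityTheory
-- `‖M‖` for a real matrix `M` is the spectral norm (operator norm between Euclidean spaces).
open scoped Matrix Matrix.Norms.L2Operator

/-- The matrix `∑ i, (A xᵢ) bᵢᵀ`, for vectors `xᵢ ∈ ℝᵐ`, `bᵢ ∈ ℝ^q` and a `q × m` matrix `A`. -/
noncomputable def sumOuter {n m q : ℕ} (A : Matrix (Fin q) (Fin m) ℝ)
    (b : Fin n → EuclideanSpace ℝ (Fin q)) (x : Fin n → EuclideanSpace ℝ (Fin m)) :
    Matrix (Fin q) (Fin q) ℝ :=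
  ∑ i, Matrix.vecMulVec (A *ᵥ (x i).ofLp) (b i).ofLp

/-- `L = max (Tr(AᵀA) ‖∑ bᵢ bᵢᵀ‖, (∑ ‖bᵢ‖²) ‖A Aᵀ‖)`; matrices carry the spectral norm and
vectors the Euclidean norm. -/
noncomputable def varianceParam {n m q : ℕ} (A : Matrix (Fin q) (Fin m) ℝ)
    (b : Fin n → EuclideanSpace ℝ (Fin q)) : ℝ :=
  max ((Aᵀ * A).trace * ‖∑ i, Matrix.vecMulVec (b i).ofLp (b i).ofLp‖)
    ((∑ i, ‖b i‖ ^ 2) * ‖A * Aᵀ‖)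

/-!
The random matrix is `Z = A X B`, where the columns of `X` are the vectors `εᵢ` and the rows of `B`
are the vectors `bᵢ`; the entries of `X` are independent standard Gaussian variables. Put
`P = A Aᵀ`, `Q = Bᵀ B` and `v = ‖P‖ ‖Q‖`, so that `L = max (tr P ‖Q‖) (tr Q ‖P‖)` lies between `v`
and `q v`. The bound proved is `q exp (-t² / (2 L))`; it is obtained from the moments
`M p = E tr (Z Zᵀ) ^ p`.

Gaussian integration by parts (`integral_trace_pow_succ`) expresses `M (p + 1)` through the expected
values of `∑ k ≤ p, tr (Q (Zᵀ Z) ^ k) tr (P (Z Zᵀ) ^ (p - k))` and of a sum of `p` single traces in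
which `P` and `Q` are separated by powers of `Z`. In an eigenbasis of the self-adjoint dilation of
`Z`, every eigenvector for a nonzero eigenvalue has half of its mass in each block
(`exists_dilation_coordinates`). Young's inequality replaces mixed products of eigenvalues by pure
powers (`sum_trace_mul_trace_le`, `sum_trace_cross_le`), whence
`M (p + 1) ≤ ((p + 1) L + p v) M p` for `p ≥ 1`, with `M 1 = tr P tr Q ≤ L² / v`. The third moment
is estimated slightly more carefully. With `ℓ = L / v ∈ [1, q]` and `x = t² / L`, Markov's
inequality yields `gaussTail_moment_bounds`.

It remains to see that these bounds imply a tail of at most `q exp (-x / 2)`. For `x ≤ 2 log q`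
this is trivial, and for `x ≥ 5` and `q ≥ 2` the moment of order `p ≈ x / 2` suffices
(`TailMoments.le_of_five_le`). Between these, the third moment suffices if `q ≥ 5`. For `q ≤ 4` and
`ℓ` close to `q` low moments are not enough. There the spectral norm is bounded by the Frobenius
norm: the vectorization of `Z` is Gaussian with covariance at most `v`, so the tail is at most that
of `√v` times the norm of a standard Gaussian vector in dimension `q²`
(`gaussTail_le_stdGaussian`), which is explicit and small because `t² / v = ℓ x`. A finite number
of intervals for `ℓ` then covers all cases.
-/

/-! ### Gaussian integration by parts for polynomials -/

lemma integrable_pow_gaussianReal (k : ℕ) :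
    Integrable (fun x : ℝ => x ^ k) (gaussianReal 0 1) := by
  have h := memLp_id_gaussianReal (μ := 0) (v := 1) (k : NNReal)
  refine (h.integrable_norm_pow').mono' (by fun_prop) ?_
  simp

/-- For `k = 0` the junk value `0 - 1 = 0` is harmless, being multiplied by `k`. -/
lemma integral_pow_gaussianReal_succ (k : ℕ) :
    ∫ x, x ^ (k + 1) ∂(gaussianReal 0 1) = k * ∫ x, x ^ (k - 1) ∂(gaussianReal 0 1) := by
  have hpdf : ∀ x : ℝ, gaussianPDFReal 0 1 x
      = (√(2 * Real.pi))⁻¹ * Real.exp (-(1 / 2) * x ^ 2) := by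
    intro x; simp only [gaussianPDFReal]; norm_num; left; ring_nf
  have hint : ∀ j : ℕ, Integrable (fun x : ℝ => x ^ j * gaussianPDFReal 0 1 x) := by
    intro j
    have h := (integrable_rpow_mul_exp_neg_mul_sq (b := 1 / 2) (by norm_num) (s := j)
      (by have : (0 : ℝ) ≤ j := j.cast_nonneg
          linarith)).const_mul (√(2 * Real.pi))⁻¹
    refine h.congr (Filter.Eventually.of_forall fun x => ?_)
    simp only [hpdf, Real.rpow_natCast]; ring
  have hd : ∀ x : ℝ, HasDerivAt (gaussianPDFReal 0 1) (-x * gaussianPDFReal 0 1 x) x := by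
    intro x
    have h : HasDerivAt (fun x : ℝ => (√(2 * Real.pi))⁻¹ * Real.exp (-(1 / 2) * x ^ 2))
        ((√(2 * Real.pi))⁻¹ * (Real.exp (-(1 / 2) * x ^ 2) * (-(1 / 2) * (2 * x)))) x := by
      have h2 : HasDerivAt (fun x : ℝ => x ^ 2) (2 * x) x := by simpa using hasDerivAt_pow 2 x
      exact ((h2.const_mul _).exp).const_mul _
    rw [show gaussianPDFReal 0 1 = fun x : ℝ =>
      (√(2 * Real.pi))⁻¹ * Real.exp (-(1 / 2) * x ^ 2) from funext hpdf]
    convert h using 1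
    ring
  have key := integral_mul_deriv_eq_deriv_mul_of_integrable
    (u := fun x : ℝ => x ^ k) (u' := fun x => k * x ^ (k - 1))
    (v := gaussianPDFReal 0 1) (v' := fun x => -x * gaussianPDFReal 0 1 x)
    (fun x _ => hasDerivAt_pow k x) (fun x _ => hd x)
    (((hint (k + 1)).neg).congr (Filter.Eventually.of_forall fun x => by
      simp only [Pi.neg_apply, Pi.mul_apply]; ring))
    (((hint (k - 1)).const_mul (k : ℝ)).congr (Filter.Eventually.of_forall fun x => by
      simp only [Pi.mul_apply]; ring))
    (hint k)
  rw [integral_gaussianReal_eq_integral_smul one_ne_zero,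
    integral_gaussianReal_eq_integral_smul one_ne_zero]
  simp only [smul_eq_mul]
  have e1 : ∀ x : ℝ, gaussianPDFReal 0 1 x * x ^ (k + 1)
      = -(x ^ k * (-x * gaussianPDFReal 0 1 x)) := fun x => by ring
  have e2 : ∀ x : ℝ, k * x ^ (k - 1) * gaussianPDFReal 0 1 x
      = k * (gaussianPDFReal 0 1 x * x ^ (k - 1)) := fun x => by ring
  simp_rw [e1, integral_neg, key, e2, integral_const_mul, neg_neg]

section Polynomial

variable {κ : Type*} [Fintype κ]

/-- The law of a family, indexed by `κ`, of independent standard Gaussian variables. -/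
noncomputable abbrev gaussPi (κ : Type*) [Fintype κ] : Measure (κ → ℝ) :=
  Measure.pi fun _ : κ => gaussianReal 0 1

lemma eval_monomial_eq_prod (s : κ →₀ ℕ) (a : ℝ) (x : κ → ℝ) :
    MvPolynomial.eval x (MvPolynomial.monomial s a) = a * ∏ i, x i ^ s i := by
  rw [MvPolynomial.eval_monomial, Finsupp.prod_fintype _ _ (fun i => pow_zero _)]

lemma integrable_eval_gaussPi (p : MvPolynomial κ ℝ) :
    Integrable (fun x => MvPolynomial.eval x p) (gaussPi κ) := by
  induction p using MvPolynomial.induction_on' with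
  | monomial s a =>
    simp_rw [eval_monomial_eq_prod]
    exact (Integrable.fintype_prod fun i => integrable_pow_gaussianReal (s i)).const_mul a
  | add p q hp hq => simp only [map_add]; exact hp.add hq

/-- Expectation of a polynomial in independent standard Gaussian variables. -/
noncomputable def gaussExp : MvPolynomial κ ℝ →ₗ[ℝ] ℝ where
  toFun p := ∫ x, MvPolynomial.eval x p ∂(gaussPi κ)
  map_add' p q := by
    simp only [map_add]
    exact integral_add (integrable_eval_gaussPi p) (integrable_eval_gaussPi q)
  map_smul' c p := by
    simp only [MvPolynomial.smul_eval, RingHom.id_apply, smul_eq_mul]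
    exact integral_const_mul _ _

lemma gaussExp_apply (p : MvPolynomial κ ℝ) :
    gaussExp p = ∫ x, MvPolynomial.eval x p ∂(gaussPi κ) := rfl

lemma gaussExp_monomial (s : κ →₀ ℕ) (a : ℝ) :
    gaussExp (MvPolynomial.monomial s a) = a * ∏ i, ∫ x, x ^ s i ∂(gaussianReal 0 1) := by
  rw [gaussExp_apply]
  simp_rw [eval_monomial_eq_prod]
  rw [integral_const_mul, integral_fintype_prod_eq_prod (f := fun i (x : ℝ) => x ^ s i)]

/-- Gaussian integration by parts: `E[Xᵢ p(X)] = E[∂ᵢ p(X)]`. -/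
lemma gaussExp_X_mul [DecidableEq κ] (i : κ) (p : MvPolynomial κ ℝ) :
    gaussExp (MvPolynomial.X i * p) = gaussExp (MvPolynomial.pderiv i p) := by
  induction p using MvPolynomial.induction_on' with
  | monomial s a =>
    rw [MvPolynomial.pderiv_monomial, MvPolynomial.X, MvPolynomial.monomial_mul,
      gaussExp_monomial, gaussExp_monomial,
      ← Finset.mul_prod_erase _
        (fun j => ∫ x : ℝ, x ^ (Finsupp.single i 1 + s : κ →₀ ℕ) j ∂(gaussianReal 0 1))
        (Finset.mem_univ i),
      ← Finset.mul_prod_erase _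
        (fun j => ∫ x : ℝ, x ^ (s - Finsupp.single i 1 : κ →₀ ℕ) j ∂(gaussianReal 0 1))
        (Finset.mem_univ i)]
    have h : ∀ j ∈ Finset.univ.erase i,
        (∫ x : ℝ, x ^ (Finsupp.single i 1 + s : κ →₀ ℕ) j ∂(gaussianReal 0 1))
          = ∫ x : ℝ, x ^ (s - Finsupp.single i 1 : κ →₀ ℕ) j ∂(gaussianReal 0 1) := by
      intro j hj
      have hne : i ≠ j := (Finset.ne_of_mem_erase hj).symm
      simp [Finsupp.single_eq_of_ne' hne]
    rw [Finset.prod_congr rfl h]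
    simp only [Finsupp.coe_add, Finsupp.coe_tsub, Pi.add_apply, Pi.sub_apply,
      Finsupp.single_eq_same, add_comm 1 (s i), integral_pow_gaussianReal_succ]
    ring
  | add p q hp hq => rw [mul_add, map_add, map_add, map_add, hp, hq]

end Polynomial

/-! ### Matrices of polynomials and their derivatives -/

section DerivationMatrix

variable {R a b c r s : Type*} [CommRing R] [Algebra ℝ R] [Fintype b]
  [Fintype r] [DecidableEq r] [Fintype s] [DecidableEq s]

lemma Matrix.map_derivation_mul (D : Derivation ℝ R R) (M : Matrix a b R) (N : Matrix b c R) :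
    (M * N).map D = M.map D * N + M * N.map D := by
  ext i j
  simp only [Matrix.map_apply, Matrix.mul_apply, Matrix.add_apply, map_sum, Derivation.leibniz,
    smul_eq_mul, ← Finset.sum_add_distrib]
  exact Finset.sum_congr rfl fun k _ => by ring

/-- The noncommutative Leibniz rule for `Zᵀ (Z Zᵀ) ^ p`, split according to whether the
differentiated factor is a `Zᵀ` or a `Z`. -/
lemma Matrix.map_derivation_transpose_mul_pow (D : Derivation ℝ R R) (Z : Matrix r s R) (p : ℕ) :
    (Zᵀ * (Z * Zᵀ) ^ p).map D
      = ∑ k ∈ Finset.range (p + 1), (Zᵀ * Z) ^ k * (Z.map D)ᵀ * (Z * Zᵀ) ^ (p - k)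
        + ∑ k ∈ Finset.range p,
          ((Zᵀ * Z) ^ k * Zᵀ) * Z.map D * (Zᵀ * (Z * Zᵀ) ^ (p - 1 - k)) := by
  induction p with
  | zero => simp [Matrix.transpose_map]
  | succ p ih =>
    have h : Zᵀ * (Z * Zᵀ) ^ (p + 1) = (Zᵀ * Z) * (Zᵀ * (Z * Zᵀ) ^ p) := by
      rw [pow_succ']; simp only [Matrix.mul_assoc]
    rw [h, Matrix.map_derivation_mul, ih, Matrix.map_derivation_mul,
      Finset.sum_range_succ' (fun k => (Zᵀ * Z) ^ k * (Z.map D)ᵀ * (Z * Zᵀ) ^ (p + 1 - k)) (p + 1),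
      Finset.sum_range_succ' (fun k => ((Zᵀ * Z) ^ k * Zᵀ) * Z.map D *
        (Zᵀ * (Z * Zᵀ) ^ (p + 1 - 1 - k))) p, Matrix.mul_add, Matrix.mul_sum, Matrix.mul_sum]
    have e1 : ∀ k ∈ Finset.range (p + 1),
        Zᵀ * Z * ((Zᵀ * Z) ^ k * (Z.map D)ᵀ * (Z * Zᵀ) ^ (p - k))
          = (Zᵀ * Z) ^ (k + 1) * (Z.map D)ᵀ * (Z * Zᵀ) ^ (p + 1 - (k + 1)) := by
      intro k _
      rw [pow_succ', Nat.add_sub_add_right]; simp only [Matrix.mul_assoc]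
    have e2 : ∀ k ∈ Finset.range p,
        Zᵀ * Z * (((Zᵀ * Z) ^ k * Zᵀ) * Z.map D * (Zᵀ * (Z * Zᵀ) ^ (p - 1 - k)))
          = ((Zᵀ * Z) ^ (k + 1) * Zᵀ) * Z.map D * (Zᵀ * (Z * Zᵀ) ^ (p + 1 - 1 - (k + 1))) := by
      intro k _
      rw [pow_succ', show p + 1 - 1 - (k + 1) = p - 1 - k by omega]; simp only [Matrix.mul_assoc]
    rw [Finset.sum_congr rfl e1, Finset.sum_congr rfl e2, Matrix.transpose_map, Matrix.add_mul]
    have e3 : (Z.map D)ᵀ * Z * (Zᵀ * (Z * Zᵀ) ^ p) = (Z.map D)ᵀ * (Z * Zᵀ) ^ (p + 1) := by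
      rw [pow_succ']; simp only [Matrix.mul_assoc]
    rw [e3]
    simp only [pow_zero, Nat.sub_zero, Nat.add_sub_cancel, Matrix.one_mul]
    abel

end DerivationMatrix

section GaussMatrix

variable {m n r s : Type*} [Fintype m] [Fintype n] [DecidableEq m] [DecidableEq n]

/-- A real matrix regarded as a matrix of constant polynomials. -/
noncomputable def constMatrix (κ : Type*) (A : Matrix r s ℝ) : Matrix r s (MvPolynomial κ ℝ) :=
  A.map MvPolynomial.C

/-- The `m × n` matrix of indeterminates. -/
noncomputable def varMatrix (m n : Type*) : Matrix m n (MvPolynomial (m × n) ℝ) :=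
  Matrix.of fun l i => MvPolynomial.X (l, i)

/-- The matrix `A X B`, where `X` is the matrix of indeterminates. -/
noncomputable def polyMatrix (A : Matrix r m ℝ) (B : Matrix n s ℝ) :
    Matrix r s (MvPolynomial (m × n) ℝ) :=
  constMatrix (m × n) A * varMatrix m n * constMatrix (m × n) B

/-- The matrix `A X B`, with `X` the matrix with entries `x (l, i)`. -/
noncomputable def gaussMatrix (A : Matrix r m ℝ) (B : Matrix n s ℝ) (x : m × n → ℝ) :
    Matrix r s ℝ :=
  A * Matrix.of (fun l i => x (l, i)) * B

lemma constMatrix_map_eval {κ : Type*} (A : Matrix r s ℝ) (x : κ → ℝ) :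
    (constMatrix κ A).map (MvPolynomial.eval x) = A := by
  ext i j; simp [constMatrix]

omit [DecidableEq m] [DecidableEq n] in
lemma polyMatrix_map_eval (A : Matrix r m ℝ) (B : Matrix n s ℝ) (x : m × n → ℝ) :
    (polyMatrix A B).map (MvPolynomial.eval x) = gaussMatrix A B x := by
  have hX : (varMatrix m n).map (MvPolynomial.eval x) = Matrix.of fun l i => x (l, i) := by
    ext i j; simp [varMatrix]
  rw [polyMatrix, gaussMatrix, Matrix.map_mul, Matrix.map_mul, constMatrix_map_eval,
    constMatrix_map_eval, hX]

lemma constMatrix_map_pderiv {κ : Type*} (A : Matrix r s ℝ) (k : κ) :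
    (constMatrix κ A).map (MvPolynomial.pderiv k) = 0 := by
  ext1 i j; simp [constMatrix]

lemma polyMatrix_map_pderiv (A : Matrix r m ℝ) (B : Matrix n s ℝ) (l : m) (i : n) :
    (polyMatrix A B).map (MvPolynomial.pderiv (l, i))
      = constMatrix (m × n) A * Matrix.single l i (1 : MvPolynomial (m × n) ℝ)
        * constMatrix (m × n) B := by
  have hX : (varMatrix m n).map (MvPolynomial.pderiv (l, i))
      = Matrix.single l i (1 : MvPolynomial (m × n) ℝ) := by
    ext1 l' i'
    by_cases h : l = l' ∧ i = i'
    · obtain ⟨rfl, rfl⟩ := h; simp [varMatrix]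
    · rw [Matrix.single_apply_of_ne _ _ _ _ _ h]
      simp only [varMatrix, Matrix.map_apply, Matrix.of_apply]
      refine MvPolynomial.pderiv_X_of_ne ?_
      intro h2; simp only [Prod.mk.injEq] at h2; exact h ⟨h2.1.symm, h2.2.symm⟩
  rw [polyMatrix, Matrix.map_derivation_mul, Matrix.map_derivation_mul, constMatrix_map_pderiv,
    constMatrix_map_pderiv, hX]
  simp

lemma mul_single_mul_apply {R a b : Type*} [CommRing R] (M : Matrix a m R) (N : Matrix n b R)
    (l : m) (i : n) (j : a) (k : b) :
    (M * Matrix.single l i (1 : R) * N : Matrix a b R) j k = M j l * N i k := by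
  rw [Matrix.mul_assoc]
  simp [Matrix.mul_apply, Matrix.single_apply, ite_and]

/-- Gaussian integration by parts for `E tr (Z Y)`, where `Z = A X B`. -/
lemma gaussExp_trace_mul [Fintype r] [Fintype s] (A : Matrix r m ℝ) (B : Matrix n s ℝ)
    (Y : Matrix s r (MvPolynomial (m × n) ℝ)) :
    gaussExp (polyMatrix A B * Y).trace
      = gaussExp (∑ l, ∑ i, (constMatrix (m × n) B * Y.map (MvPolynomial.pderiv (l, i))
          * constMatrix (m × n) A : Matrix n m (MvPolynomial (m × n) ℝ)) i l) := by
  have h : (polyMatrix A B * Y).trace = ∑ l, ∑ i, MvPolynomial.X (l, i) *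
      (constMatrix (m × n) B * Y * constMatrix (m × n) A :
        Matrix n m (MvPolynomial (m × n) ℝ)) i l := by
    rw [polyMatrix, Matrix.mul_assoc, Matrix.mul_assoc, Matrix.trace_mul_comm, Matrix.mul_assoc]
    simp only [Matrix.trace, Matrix.diag_apply]
    refine Finset.sum_congr rfl fun l _ => ?_
    rw [Matrix.mul_apply]
    simp only [varMatrix, Matrix.of_apply, Matrix.mul_assoc]
  rw [h]
  simp only [map_sum]
  refine Finset.sum_congr rfl fun l _ => Finset.sum_congr rfl fun i _ => ?_
  rw [gaussExp_X_mul]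
  congr 1
  have := congrFun (congrFun (Matrix.map_derivation_mul (MvPolynomial.pderiv (l, i))
    (constMatrix (m × n) B * Y) (constMatrix (m × n) A)) i) l
  rw [Matrix.map_apply] at this
  rw [this, Matrix.map_derivation_mul, constMatrix_map_pderiv, constMatrix_map_pderiv]
  simp

/-- Summing over all partial derivatives, a factor `∂Zᵀ` separates a product into two traces. -/
lemma sum_mul_transpose_pderiv [Fintype r] [Fintype s] (A : Matrix r m ℝ) (B : Matrix n s ℝ)
    (M : Matrix s s (MvPolynomial (m × n) ℝ)) (N : Matrix r r (MvPolynomial (m × n) ℝ)) :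
    ∑ l, ∑ i, (constMatrix (m × n) B
          * (M * ((polyMatrix A B).map (MvPolynomial.pderiv (l, i)))ᵀ * N)
          * constMatrix (m × n) A : Matrix n m (MvPolynomial (m × n) ℝ)) i l
      = (constMatrix (m × n) (Bᵀ * B) * M).trace * (constMatrix (m × n) (A * Aᵀ) * N).trace := by
  have e : ∀ l i, (constMatrix (m × n) B * (M * ((polyMatrix A B).map
        (MvPolynomial.pderiv (l, i)))ᵀ * N) * constMatrix (m × n) A :
          Matrix n m (MvPolynomial (m × n) ℝ)) i l
      = (constMatrix (m × n) B * M * (constMatrix (m × n) B)ᵀ : Matrix n n _) i i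
        * ((constMatrix (m × n) A)ᵀ * N * constMatrix (m × n) A : Matrix m m _) l l := by
    intro l i
    rw [polyMatrix_map_pderiv, ← mul_single_mul_apply]
    simp only [Matrix.transpose_mul, Matrix.transpose_single, Matrix.mul_assoc]
  simp_rw [e]
  have hA : constMatrix (m × n) (A * Aᵀ)
      = constMatrix (m × n) A * (constMatrix (m × n) A)ᵀ := by
    simp [constMatrix, Matrix.map_mul, Matrix.transpose_map]
  have hB : constMatrix (m × n) (Bᵀ * B)
      = (constMatrix (m × n) B)ᵀ * constMatrix (m × n) B := by
    simp [constMatrix, Matrix.map_mul, Matrix.transpose_map]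
  rw [hA, hB, Matrix.mul_assoc (constMatrix (m × n) B)ᵀ,
    Matrix.trace_mul_comm (constMatrix (m × n) B)ᵀ, Matrix.mul_assoc (constMatrix (m × n) A),
    Matrix.trace_mul_comm (constMatrix (m × n) A)]
  simp only [Matrix.trace, Matrix.diag_apply, Finset.sum_mul_sum]
  rw [Finset.sum_comm]

/-- Summing over all partial derivatives, a factor `∂Z` is contracted into a single trace. -/
lemma sum_mul_pderiv [Fintype r] [Fintype s] (A : Matrix r m ℝ) (B : Matrix n s ℝ)
    (M N : Matrix s r (MvPolynomial (m × n) ℝ)) :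
    ∑ l, ∑ i, (constMatrix (m × n) B * (M * (polyMatrix A B).map (MvPolynomial.pderiv (l, i)) * N)
          * constMatrix (m × n) A : Matrix n m (MvPolynomial (m × n) ℝ)) i l
      = (constMatrix (m × n) (Bᵀ * B) * M * constMatrix (m × n) (A * Aᵀ) * Nᵀ).trace := by
  have e : ∀ l i, (constMatrix (m × n) B * (M * (polyMatrix A B).map
        (MvPolynomial.pderiv (l, i)) * N) * constMatrix (m × n) A :
          Matrix n m (MvPolynomial (m × n) ℝ)) i l
      = (constMatrix (m × n) B * M * constMatrix (m × n) A : Matrix n m _) i l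
        * (constMatrix (m × n) B * N * constMatrix (m × n) A : Matrix n m _) i l := by
    intro l i
    rw [polyMatrix_map_pderiv, ← mul_single_mul_apply]
    simp only [Matrix.mul_assoc]
  simp_rw [e]
  have hA : constMatrix (m × n) (A * Aᵀ)
      = constMatrix (m × n) A * (constMatrix (m × n) A)ᵀ := by
    simp [constMatrix, Matrix.map_mul, Matrix.transpose_map]
  have hB : constMatrix (m × n) (Bᵀ * B)
      = (constMatrix (m × n) B)ᵀ * constMatrix (m × n) B := by
    simp [constMatrix, Matrix.map_mul, Matrix.transpose_map]
  rw [hA, hB]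
  simp only [Matrix.mul_assoc]
  rw [Matrix.trace_mul_comm]
  have : (constMatrix (m × n) B * (M * (constMatrix (m × n) A *
        ((constMatrix (m × n) A)ᵀ * Nᵀ))) * (constMatrix (m × n) B)ᵀ)
      = (constMatrix (m × n) B * M * constMatrix (m × n) A)
        * (constMatrix (m × n) B * N * constMatrix (m × n) A)ᵀ := by
    simp only [Matrix.transpose_mul, Matrix.mul_assoc]
  rw [this]
  simp only [Matrix.trace, Matrix.diag_apply, Matrix.mul_apply (N := (_)ᵀ), Matrix.transpose_apply]
  rw [Finset.sum_comm]
  simp only [Matrix.mul_assoc]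

end GaussMatrix

/-! ### The moment identity from integration by parts -/

section Moments

variable {m n r s : Type*} [Fintype m] [Fintype n] [DecidableEq m] [DecidableEq n]
  [Fintype r] [Fintype s]

lemma eval_trace {κ : Type*} (x : κ → ℝ) (M : Matrix r r (MvPolynomial κ ℝ)) :
    MvPolynomial.eval x M.trace = (M.map (MvPolynomial.eval x)).trace := by
  simp [Matrix.trace]

variable [DecidableEq r] [DecidableEq s]

lemma map_eval_pow {κ : Type*} (x : κ → ℝ) (M : Matrix r r (MvPolynomial κ ℝ)) (k : ℕ) :
    (M ^ k).map (MvPolynomial.eval x) = (M.map (MvPolynomial.eval x)) ^ k :=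
  ((MvPolynomial.eval x).mapMatrix).map_pow M k

omit [DecidableEq m] [DecidableEq n] [DecidableEq s] in
lemma integrable_trace_pow_gaussMatrix (A : Matrix r m ℝ) (B : Matrix n s ℝ) (p : ℕ) :
    Integrable (fun x => ((gaussMatrix A B x * (gaussMatrix A B x)ᵀ) ^ p).trace)
      (gaussPi (m × n)) := by
  refine (integrable_eval_gaussPi ((polyMatrix A B * (polyMatrix A B)ᵀ) ^ p).trace).congr
    (Filter.Eventually.of_forall fun x => ?_)
  simp only [eval_trace, map_eval_pow, Matrix.map_mul, Matrix.transpose_map, polyMatrix_map_eval]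

omit [DecidableEq m] [DecidableEq n] [DecidableEq r] [DecidableEq s] in
lemma integrable_sq_trace_gaussMatrix (A : Matrix r m ℝ) (B : Matrix n s ℝ) :
    Integrable (fun x => ((gaussMatrix A B x * (gaussMatrix A B x)ᵀ).trace) ^ 2)
      (gaussPi (m × n)) := by
  refine (integrable_eval_gaussPi ((polyMatrix A B * (polyMatrix A B)ᵀ).trace ^ 2)).congr
    (Filter.Eventually.of_forall fun x => ?_)
  simp only [eval_trace, map_pow, Matrix.map_mul, Matrix.transpose_map, polyMatrix_map_eval]

/-- The result of one Gaussian integration by parts applied to `tr (Z Zᵀ) ^ (p + 1)`,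
with `P = A Aᵀ` and `Q = Bᵀ B`. -/
noncomputable def traceContraction (P : Matrix r r ℝ) (Q : Matrix s s ℝ) (p : ℕ)
    (Z : Matrix r s ℝ) : ℝ :=
  ∑ k ∈ Finset.range (p + 1), (Q * (Zᵀ * Z) ^ k).trace * (P * (Z * Zᵀ) ^ (p - k)).trace
    + ∑ k ∈ Finset.range p,
      (Q * ((Zᵀ * Z) ^ k * Zᵀ) * P * (Zᵀ * (Z * Zᵀ) ^ (p - 1 - k))ᵀ).trace

/-- The polynomial whose evaluation is `traceContraction`. -/
noncomputable def traceContractionPoly (A : Matrix r m ℝ) (B : Matrix n s ℝ) (p : ℕ) :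
    MvPolynomial (m × n) ℝ :=
  ∑ k ∈ Finset.range (p + 1),
    (constMatrix (m × n) (Bᵀ * B) * ((polyMatrix A B)ᵀ * polyMatrix A B) ^ k).trace
      * (constMatrix (m × n) (A * Aᵀ) * (polyMatrix A B * (polyMatrix A B)ᵀ) ^ (p - k)).trace
    + ∑ k ∈ Finset.range p,
      (constMatrix (m × n) (Bᵀ * B)
        * (((polyMatrix A B)ᵀ * polyMatrix A B) ^ k * (polyMatrix A B)ᵀ)
        * constMatrix (m × n) (A * Aᵀ)
        * ((polyMatrix A B)ᵀ * (polyMatrix A B * (polyMatrix A B)ᵀ) ^ (p - 1 - k))ᵀ).trace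

omit [DecidableEq m] [DecidableEq n] in
lemma eval_traceContractionPoly (A : Matrix r m ℝ) (B : Matrix n s ℝ) (p : ℕ) (x : m × n → ℝ) :
    MvPolynomial.eval x (traceContractionPoly A B p)
      = traceContraction (A * Aᵀ) (Bᵀ * B) p (gaussMatrix A B x) := by
  simp only [traceContractionPoly, traceContraction, map_add, map_sum, map_mul, eval_trace,
    map_eval_pow, Matrix.map_mul, Matrix.transpose_map, polyMatrix_map_eval,
    constMatrix_map_eval]

omit [DecidableEq m] [DecidableEq n] in
lemma integrable_traceContraction (A : Matrix r m ℝ) (B : Matrix n s ℝ) (p : ℕ) :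
    Integrable (fun x => traceContraction (A * Aᵀ) (Bᵀ * B) p (gaussMatrix A B x))
      (gaussPi (m × n)) :=
  (integrable_eval_gaussPi (traceContractionPoly A B p)).congr
    (Filter.Eventually.of_forall fun x => eval_traceContractionPoly A B p x)

/-- Gaussian integration by parts, applied to the leading factor of `tr (Z (Zᵀ (Z Zᵀ) ^ p))`. -/
lemma integral_trace_pow_succ (A : Matrix r m ℝ) (B : Matrix n s ℝ) (p : ℕ) :
    ∫ x, ((gaussMatrix A B x * (gaussMatrix A B x)ᵀ) ^ (p + 1)).trace ∂(gaussPi (m × n))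
      = ∫ x, traceContraction (A * Aᵀ) (Bᵀ * B) p (gaussMatrix A B x) ∂(gaussPi (m × n)) := by
  have h := gaussExp_trace_mul A B
    ((polyMatrix A B)ᵀ * (polyMatrix A B * (polyMatrix A B)ᵀ) ^ p)
  simp_rw [Matrix.map_derivation_transpose_mul_pow, Matrix.mul_add, Matrix.add_mul,
    Matrix.mul_sum, Matrix.sum_mul, Matrix.add_apply, Matrix.sum_apply, Finset.sum_add_distrib]
    at h
  have swap : ∀ (N : ℕ) (f : m → n → ℕ → MvPolynomial (m × n) ℝ),
      ∑ l, ∑ i, ∑ k ∈ Finset.range N, f l i k = ∑ k ∈ Finset.range N, ∑ l, ∑ i, f l i k := by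
    intro N f
    rw [Finset.sum_comm]
    rw [Finset.sum_comm]
    simp_rw [Finset.sum_comm (s := Finset.univ (α := n)) (t := Finset.range N)]
    rw [Finset.sum_comm]
  rw [swap, swap] at h
  simp_rw [sum_mul_transpose_pderiv, sum_mul_pderiv] at h
  change _ = gaussExp (traceContractionPoly A B p) at h
  rw [gaussExp_apply, gaussExp_apply] at h
  simp_rw [eval_traceContractionPoly] at h
  rw [← h]
  congr 1
  ext x
  rw [← Matrix.mul_assoc, ← pow_succ']
  simp only [eval_trace, map_eval_pow, Matrix.map_mul, Matrix.transpose_map,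
    polyMatrix_map_eval]

omit [DecidableEq r] [DecidableEq s] in
/-- Gaussian integration by parts for `(tr Z Zᵀ) ^ 2 = tr (Z ((tr Z Zᵀ) Zᵀ))`. -/
lemma integral_sq_trace (A : Matrix r m ℝ) (B : Matrix n s ℝ) :
    ∫ x, (gaussMatrix A B x * (gaussMatrix A B x)ᵀ).trace ^ 2 ∂(gaussPi (m × n))
      = ∫ x, ((Bᵀ * B).trace * (A * Aᵀ).trace * (gaussMatrix A B x * (gaussMatrix A B x)ᵀ).trace
          + 2 * (Bᵀ * B * (gaussMatrix A B x)ᵀ * (A * Aᵀ) * gaussMatrix A B x).trace)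
          ∂(gaussPi (m × n)) := by
  classical
  set Z := polyMatrix A B with hZ
  have h := gaussExp_trace_mul A B ((Z * Zᵀ).trace • Zᵀ)
  set V : Matrix n m (MvPolynomial (m × n) ℝ) :=
    constMatrix (m × n) B * Zᵀ * constMatrix (m × n) A with hV
  have hD : ∀ l i, (((Z * Zᵀ).trace • Zᵀ).map (MvPolynomial.pderiv (l, i)))
      = (2 * V i l) • Zᵀ
        + (Z * Zᵀ).trace • (Z.map (MvPolynomial.pderiv (l, i)))ᵀ := by
    intro l i
    have e1 : MvPolynomial.pderiv (l, i) (Z * Zᵀ).trace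
        = 2 * V i l := by
      have : MvPolynomial.pderiv (l, i) (Z * Zᵀ).trace
          = ((Z * Zᵀ).map (MvPolynomial.pderiv (l, i))).trace := by
        simp [Matrix.trace]
      rw [this, Matrix.map_derivation_mul, Matrix.trace_add, Matrix.transpose_map,
        ← Matrix.trace_transpose (Z * _), Matrix.transpose_mul, Matrix.transpose_transpose,
        ← two_mul, hZ, polyMatrix_map_pderiv, ← hZ, Matrix.mul_assoc, Matrix.mul_assoc,
        Matrix.trace_mul_comm, Matrix.mul_assoc, Matrix.trace_single_mul, hV]
      simp
    ext1 a b
    simp only [Matrix.map_apply, Matrix.smul_apply, Matrix.add_apply, Matrix.transpose_apply,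
      smul_eq_mul, Derivation.leibniz, e1]
    ring
  simp_rw [hD, Matrix.mul_add, Matrix.add_mul, Matrix.mul_smul, Matrix.smul_mul,
    Matrix.add_apply, Finset.sum_add_distrib, Matrix.smul_apply, smul_eq_mul, ← Finset.mul_sum] at h
  have e2 := sum_mul_transpose_pderiv A B 1 1
  simp only [Matrix.mul_one, Matrix.one_mul] at e2
  rw [← hZ] at e2
  rw [e2] at h
  have e3 : ∑ l, ∑ i, (2 * V i l) * V i l
      = 2 * (constMatrix (m × n) (Bᵀ * B) * Zᵀ * constMatrix (m × n) (A * Aᵀ) * Z).trace := by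
    have := sum_mul_pderiv A B Zᵀ Zᵀ
    rw [Matrix.transpose_transpose] at this
    rw [← this]
    simp_rw [Finset.mul_sum]
    refine Finset.sum_congr rfl fun l _ => Finset.sum_congr rfl fun i _ => ?_
    rw [polyMatrix_map_pderiv, mul_assoc, hV, ← mul_single_mul_apply]
    simp only [Matrix.mul_assoc]
  rw [e3, gaussExp_apply, gaussExp_apply] at h
  have e4 : ∀ x, MvPolynomial.eval x (2 : MvPolynomial (m × n) ℝ) = 2 := fun x => by simp
  simp only [eval_trace, Matrix.map_mul, Matrix.transpose_map, hZ, polyMatrix_map_eval, map_add,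
    map_mul, constMatrix_map_eval, Matrix.trace_smul, smul_eq_mul, e4] at h
  simp_rw [sq, h]
  congr 1
  ext x
  ring

end Moments

/-! ### Diagonalization of the self-adjoint dilation -/

section Dilation

variable {r s : Type*} [Fintype r] [Fintype s] [DecidableEq r] [DecidableEq s]

lemma dotProduct_mulVec_le_norm (M : Matrix r r ℝ) (x : r → ℝ) :
    x ⬝ᵥ (M *ᵥ x) ≤ ‖M‖ * (x ⬝ᵥ x) := by
  have h := real_inner_le_norm (WithLp.toLp 2 x)
    (Matrix.toEuclideanCLM (n := r) (𝕜 := ℝ) M (WithLp.toLp 2 x))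
  have h2 := (Matrix.toEuclideanCLM (n := r) (𝕜 := ℝ) M).le_opNorm (WithLp.toLp 2 x)
  rw [Matrix.inner_toEuclideanCLM] at h
  rw [Matrix.l2_opNorm_toEuclideanCLM] at h2
  have h3 : x ⬝ᵥ x = ‖WithLp.toLp 2 x‖ * ‖WithLp.toLp 2 x‖ := by
    rw [← sq, EuclideanSpace.real_norm_sq_eq]
    simp [dotProduct, sq]
  rw [h3]
  refine h.trans ?_
  calc _ ≤ ‖WithLp.toLp 2 x‖ * (‖M‖ * ‖WithLp.toLp 2 x‖) := by gcongr
    _ = _ := by ring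

/-- The self-adjoint dilation of a rectangular matrix. -/
def dilation (Z : Matrix r s ℝ) : Matrix (r ⊕ s) (r ⊕ s) ℝ := Matrix.fromBlocks 0 Z Zᵀ 0

omit [Fintype r] [Fintype s] [DecidableEq r] [DecidableEq s] in
lemma isHermitian_dilation (Z : Matrix r s ℝ) : (dilation Z).IsHermitian := by
  rw [Matrix.IsHermitian, Matrix.conjTranspose_eq_transpose_of_trivial, dilation,
    Matrix.fromBlocks_transpose]
  simp

lemma dilation_pow_even (Z : Matrix r s ℝ) (k : ℕ) :
    dilation Z ^ (2 * k) = Matrix.fromBlocks ((Z * Zᵀ) ^ k) 0 0 ((Zᵀ * Z) ^ k) := by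
  induction k with
  | zero => simp
  | succ k ih =>
    rw [mul_add, mul_one, pow_add, ih, sq, dilation, Matrix.fromBlocks_multiply,
      Matrix.fromBlocks_multiply]
    simp [pow_succ]

lemma dilation_pow_odd (Z : Matrix r s ℝ) (k : ℕ) :
    dilation Z ^ (2 * k + 1)
      = Matrix.fromBlocks 0 ((Z * Zᵀ) ^ k * Z) ((Zᵀ * Z) ^ k * Zᵀ) 0 := by
  rw [pow_succ, dilation_pow_even, dilation, Matrix.fromBlocks_multiply]
  simp

lemma trace_dilation_pow_even (Z : Matrix r s ℝ) {k : ℕ} (hk : k ≠ 0) :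
    (dilation Z ^ (2 * k)).trace = 2 * ((Z * Zᵀ) ^ k).trace := by
  obtain ⟨k, rfl⟩ := Nat.exists_eq_succ_of_ne_zero hk
  have htr : ∀ (M : Matrix r r ℝ) (N : Matrix s s ℝ),
      (Matrix.fromBlocks M 0 0 N).trace = M.trace + N.trace := by
    intro M N; simp [Matrix.trace, Fintype.sum_sum_type]
  rw [dilation_pow_even, htr, two_mul]
  congr 1
  have : ∀ j, (Zᵀ * Z) ^ j * Zᵀ = Zᵀ * (Z * Zᵀ) ^ j := by
    intro j
    induction j with
    | zero => simp
    | succ j ih => rw [pow_succ', Matrix.mul_assoc, ih, pow_succ']; simp only [Matrix.mul_assoc]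
  rw [Nat.succ_eq_add_one, pow_succ, ← Matrix.mul_assoc, this, Matrix.mul_assoc,
    Matrix.trace_mul_comm, pow_succ]
  simp only [Matrix.mul_assoc]

/-- Orthogonal diagonalization of a real symmetric matrix, together with all its powers. -/
lemma Matrix.IsHermitian.exists_orthogonal_diagonalization {t : Type*} [Fintype t] [DecidableEq t]
    {H : Matrix t t ℝ} (hH : H.IsHermitian) :
    ∃ (U : Matrix t t ℝ) (h : t → ℝ), Uᵀ * U = 1 ∧ U * Uᵀ = 1 ∧
      ∀ k, H ^ k = U * Matrix.diagonal (fun i => h i ^ k) * Uᵀ := by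
  set U : Matrix t t ℝ := (hH.eigenvectorUnitary).1 with hU
  have h1 : Uᵀ * U = 1 := by
    have := Unitary.coe_star_mul_self hH.eigenvectorUnitary
    rwa [Matrix.star_eq_conjTranspose, Matrix.conjTranspose_eq_transpose_of_trivial] at this
  have h2 : U * Uᵀ = 1 := by
    have := Unitary.mul_star_self_of_mem hH.eigenvectorUnitary.2
    rwa [Matrix.star_eq_conjTranspose, Matrix.conjTranspose_eq_transpose_of_trivial] at this
  refine ⟨U, hH.eigenvalues, h1, h2, fun k => ?_⟩
  have hs := hH.spectral_theorem
  rw [Unitary.conjStarAlgAut_apply, Matrix.star_eq_conjTranspose,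
    Matrix.conjTranspose_eq_transpose_of_trivial] at hs
  induction k with
  | zero => simp [h2]
  | succ k ih =>
    rw [pow_succ, ih]
    nth_rw 2 [hs]
    have : ∀ D E : Matrix t t ℝ, U * D * Uᵀ * (U * E * Uᵀ) = U * (D * E) * Uᵀ := by
      intro D E
      calc U * D * Uᵀ * (U * E * Uᵀ) = U * D * (Uᵀ * U) * E * Uᵀ := by
            simp only [Matrix.mul_assoc]
        _ = _ := by rw [h1]; simp only [Matrix.mul_assoc, Matrix.one_mul]
    rw [← hU, this, Matrix.diagonal_mul_diagonal]
    rfl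

lemma trace_mul_conj_diagonal {t : Type*} [Fintype t] [DecidableEq t] (M U : Matrix t t ℝ)
    (d : t → ℝ) :
    (M * (U * Matrix.diagonal d * Uᵀ)).trace = ∑ i, (Uᵀ * M * U) i i * d i := by
  have : (M * (U * Matrix.diagonal d * Uᵀ)).trace = ((Uᵀ * M * U) * Matrix.diagonal d).trace := by
    rw [← Matrix.mul_assoc, Matrix.trace_mul_comm]; simp only [Matrix.mul_assoc]
  rw [this]
  simp [Matrix.trace, Matrix.mul_diagonal]

lemma trace_mul_conj_diagonal_mul_conj_diagonal {t : Type*} [Fintype t] [DecidableEq t]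
    (M N U : Matrix t t ℝ) (d e : t → ℝ) :
    (M * (U * Matrix.diagonal d * Uᵀ) * N * (U * Matrix.diagonal e * Uᵀ)).trace
      = ∑ i, ∑ j, (Uᵀ * M * U) i j * d j * ((Uᵀ * N * U) j i * e i) := by
  have : (M * (U * Matrix.diagonal d * Uᵀ) * N * (U * Matrix.diagonal e * Uᵀ)).trace
      = (((Uᵀ * M * U) * Matrix.diagonal d) * ((Uᵀ * N * U) * Matrix.diagonal e)).trace := by
    rw [← Matrix.mul_assoc (M * _ * N), Matrix.trace_mul_comm]; simp only [Matrix.mul_assoc]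
  rw [this]
  simp only [Matrix.trace, Matrix.diag_apply, Matrix.mul_apply (M := _ * Matrix.diagonal d),
    Matrix.mul_diagonal]

omit [DecidableEq r] [DecidableEq s] in
/-- An eigenvector of the dilation for a nonzero eigenvalue has half of its mass in each block. -/
lemma dilation_eigenvector_mass {Z : Matrix r s ℝ} {x : r → ℝ} {y : s → ℝ} {h : ℝ} (h0 : h ≠ 0)
    (hx : Z *ᵥ y = h • x) (hy : Zᵀ *ᵥ x = h • y) (h1 : x ⬝ᵥ x + y ⬝ᵥ y = 1) :
    x ⬝ᵥ x = 1 / 2 ∧ y ⬝ᵥ y = 1 / 2 := by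
  have e : h * (x ⬝ᵥ x) = h * (y ⬝ᵥ y) := by
    rw [← smul_eq_mul, ← smul_eq_mul, ← dotProduct_smul, ← dotProduct_smul, ← hx, ← hy,
      Matrix.mulVec_transpose, Matrix.dotProduct_mulVec, dotProduct_comm]
  have := mul_left_cancel₀ h0 e
  constructor <;> linarith

lemma sum_pow_mul_pow_le {x y : ℝ} (hx : 0 ≤ x) (hy : 0 ≤ y) (p : ℕ) :
    ∑ k ∈ Finset.range (p + 1), x ^ k * y ^ (p - k) ≤ (p + 1) / 2 * (x ^ p + y ^ p) := by
  have h : 2 * ∑ k ∈ Finset.range (p + 1), x ^ k * y ^ (p - k)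
      = ∑ k ∈ Finset.range (p + 1), (x ^ k * y ^ (p - k) + x ^ (p - k) * y ^ k) := by
    rw [Finset.sum_add_distrib, two_mul]
    congr 1
    rw [← Finset.sum_range_reflect]
    refine Finset.sum_congr rfl fun k hk => ?_
    have : k ≤ p := Nat.lt_succ_iff.mp (Finset.mem_range.mp hk)
    simp only [Nat.add_sub_cancel, Nat.sub_sub_self this]
  have h2 : ∑ k ∈ Finset.range (p + 1), (x ^ k * y ^ (p - k) + x ^ (p - k) * y ^ k)
      ≤ ∑ k ∈ Finset.range (p + 1), (x ^ p + y ^ p) := by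
    refine Finset.sum_le_sum fun k hk => ?_
    have hkp : k ≤ p := Nat.lt_succ_iff.mp (Finset.mem_range.mp hk)
    have e : ∀ z : ℝ, z ^ p = z ^ k * z ^ (p - k) := fun z => by
      rw [← pow_add, Nat.add_sub_cancel' hkp]
    have : 0 ≤ (x ^ k - y ^ k) * (x ^ (p - k) - y ^ (p - k)) := by
      rcases le_total x y with hxy | hxy
      · exact mul_nonneg_of_nonpos_of_nonpos
          (sub_nonpos.mpr (pow_le_pow_left₀ hx hxy _)) (sub_nonpos.mpr (pow_le_pow_left₀ hx hxy _))
      · exact mul_nonneg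
          (sub_nonneg.mpr (pow_le_pow_left₀ hy hxy _)) (sub_nonneg.mpr (pow_le_pow_left₀ hy hxy _))
    rw [e x, e y]
    nlinarith
  rw [Finset.sum_const, Finset.card_range, nsmul_eq_mul] at h2
  push_cast at h2
  linarith

lemma abs_mul_abs_mul_add_pow_le (u v : ℝ) (p : ℕ) :
    |u| * |v| * ((u ^ 2) ^ p + (v ^ 2) ^ p) ≤ (u ^ 2) ^ (p + 1) + (v ^ 2) ^ (p + 1) := by
  have h : 0 ≤ ((u ^ 2) ^ p - (v ^ 2) ^ p) * (u ^ 2 - v ^ 2) := by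
    rcases le_total (u ^ 2) (v ^ 2) with hxy | hxy
    · exact mul_nonneg_of_nonpos_of_nonpos
        (sub_nonpos.mpr (pow_le_pow_left₀ (sq_nonneg _) hxy _)) (sub_nonpos.mpr hxy)
    · exact mul_nonneg
        (sub_nonneg.mpr (pow_le_pow_left₀ (sq_nonneg _) hxy _)) (sub_nonneg.mpr hxy)
  have h2 : |u| * |v| ≤ (u ^ 2 + v ^ 2) / 2 := by
    have := two_mul_le_add_sq |u| |v|
    rw [sq_abs, sq_abs] at this
    linarith
  have h3 : 0 ≤ (u ^ 2) ^ p + (v ^ 2) ^ p := by positivity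
  have h4 := mul_le_mul_of_nonneg_right h2 h3
  rw [pow_succ (u ^ 2), pow_succ (v ^ 2)]
  nlinarith

/-- The diagonalization of the dilation of `Z` in the form needed for the trace inequalities:
`a i = (h i) ^ 2` runs twice over the squared singular values of `Z` (up to zeros), and `pp`, `qq`
are the matrices of `P ⊕ 0` and `0 ⊕ Q` in the eigenbasis. -/
lemma exists_dilation_coordinates (Z : Matrix r s ℝ) {P : Matrix r r ℝ} {Q : Matrix s s ℝ}
    (hP : P.PosSemidef) (hQ : Q.PosSemidef) :
    ∃ (h : r ⊕ s → ℝ) (pp qq : Matrix (r ⊕ s) (r ⊕ s) ℝ),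
      (∀ k, (P * (Z * Zᵀ) ^ k).trace = ∑ i, pp i i * (h i ^ 2) ^ k) ∧
      (∀ k, (Q * (Zᵀ * Z) ^ k).trace = ∑ i, qq i i * (h i ^ 2) ^ k) ∧
      (∀ k, k ≠ 0 → ∑ i, (h i ^ 2) ^ k = 2 * ((Z * Zᵀ) ^ k).trace) ∧
      (∀ k l, (Q * ((Zᵀ * Z) ^ k * Zᵀ) * P * (Zᵀ * (Z * Zᵀ) ^ l)ᵀ).trace
        = ∑ i, ∑ j, qq i j * h j ^ (2 * k + 1) * (pp j i * h i ^ (2 * l + 1))) ∧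
      (∀ i j, pp i j = pp j i) ∧ (∀ i j, qq i j = qq j i) ∧
      (∀ i, 0 ≤ pp i i) ∧ (∀ i, 0 ≤ qq i i) ∧
      (∀ i, h i ≠ 0 → pp i i ≤ ‖P‖ / 2) ∧ (∀ i, h i ≠ 0 → qq i i ≤ ‖Q‖ / 2) ∧
      (∀ i, h i ≠ 0 → ∑ j, |qq i j| * |pp j i| ≤ ‖P‖ * ‖Q‖ / 2) := by
  obtain ⟨U, h, hU1, hU2, hpow⟩ := (isHermitian_dilation Z).exists_orthogonal_diagonalization
  let PP : Matrix r r ℝ → Matrix (r ⊕ s) (r ⊕ s) ℝ := fun M => Matrix.fromBlocks M 0 0 0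
  let QQ : Matrix s s ℝ → Matrix (r ⊕ s) (r ⊕ s) ℝ := fun M => Matrix.fromBlocks 0 0 0 M
  have htr : ∀ (M : Matrix r r ℝ) (N : Matrix s s ℝ) (M' : Matrix r s ℝ) (N' : Matrix s r ℝ),
      (Matrix.fromBlocks M M' N' N).trace = M.trace + N.trace := by
    intro M N M' N'; simp [Matrix.trace, Fintype.sum_sum_type]
  let x : r ⊕ s → r → ℝ := fun i a => U (Sum.inl a) i
  let y : r ⊕ s → s → ℝ := fun i a => U (Sum.inr a) i
  have hpp : ∀ M i, (Uᵀ * PP M * U) i i = x i ⬝ᵥ (M *ᵥ x i) := by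
    intro M i
    rw [Matrix.mul_assoc, Matrix.mul_apply]
    simp [PP, Matrix.mul_apply, Fintype.sum_sum_type, dotProduct, Matrix.mulVec, x]
  have hqq : ∀ M i, (Uᵀ * QQ M * U) i i = y i ⬝ᵥ (M *ᵥ y i) := by
    intro M i
    rw [Matrix.mul_assoc, Matrix.mul_apply]
    simp [QQ, Matrix.mul_apply, Fintype.sum_sum_type, dotProduct, Matrix.mulVec, y]
  have hmass1 : ∀ i, x i ⬝ᵥ x i + y i ⬝ᵥ y i = 1 := by
    intro i
    have := congrFun (congrFun hU1 i) i
    rw [Matrix.mul_apply, Matrix.one_apply_eq, Fintype.sum_sum_type] at this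
    exact this
  have hHU : dilation Z * U = U * Matrix.diagonal h := by
    have := hpow 1
    simp only [pow_one] at this
    rw [this, Matrix.mul_assoc, hU1, Matrix.mul_one]
  have hxh : ∀ i, Z *ᵥ y i = h i • x i := by
    intro i; ext a
    have := congrFun (congrFun hHU (Sum.inl a)) i
    rw [Matrix.mul_diagonal, Matrix.mul_apply, Fintype.sum_sum_type] at this
    simpa [dilation, mul_comm, Matrix.mulVec, dotProduct, x, y] using this
  have hyh : ∀ i, Zᵀ *ᵥ x i = h i • y i := by
    intro i; ext a
    have := congrFun (congrFun hHU (Sum.inr a)) i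
    rw [Matrix.mul_diagonal, Matrix.mul_apply, Fintype.sum_sum_type] at this
    simpa [dilation, mul_comm, Matrix.mulVec, dotProduct, x, y] using this
  have hmass : ∀ i, h i ≠ 0 → x i ⬝ᵥ x i = 1 / 2 ∧ y i ⬝ᵥ y i = 1 / 2 := fun i hi =>
    dilation_eigenvector_mass hi (hxh i) (hyh i) (hmass1 i)
  have hppsymm : ∀ i j, (Uᵀ * PP P * U) i j = (Uᵀ * PP P * U) j i := by
    intro i j
    have : (Uᵀ * PP P * U)ᵀ = Uᵀ * PP P * U := by
      have hPt : Pᵀ = P := by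
        have := hP.isHermitian
        rwa [Matrix.IsHermitian, Matrix.conjTranspose_eq_transpose_of_trivial] at this
      simp [PP, Matrix.transpose_mul, Matrix.mul_assoc, Matrix.fromBlocks_transpose, hPt]
    exact congrFun (congrFun this j) i
  have hqqsymm : ∀ i j, (Uᵀ * QQ Q * U) i j = (Uᵀ * QQ Q * U) j i := by
    intro i j
    have : (Uᵀ * QQ Q * U)ᵀ = Uᵀ * QQ Q * U := by
      have hQt : Qᵀ = Q := by
        have := hQ.isHermitian
        rwa [Matrix.IsHermitian, Matrix.conjTranspose_eq_transpose_of_trivial] at this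
      simp [QQ, Matrix.transpose_mul, Matrix.mul_assoc, Matrix.fromBlocks_transpose, hQt]
    exact congrFun (congrFun this j) i
  have hsq : ∀ (M : Matrix (r ⊕ s) (r ⊕ s) ℝ),
      (Uᵀ * M * U) * (Uᵀ * M * U) = Uᵀ * (M * M) * U := by
    intro M
    calc (Uᵀ * M * U) * (Uᵀ * M * U) = Uᵀ * M * (U * Uᵀ) * M * U := by
          simp only [Matrix.mul_assoc]
      _ = _ := by rw [hU2]; simp only [Matrix.mul_assoc, Matrix.one_mul]
  have hrowP : ∀ i, h i ≠ 0 → ∑ j, (Uᵀ * PP P * U) j i ^ 2 ≤ ‖P‖ ^ 2 / 2 := by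
    intro i hi
    have e : ∑ j, (Uᵀ * PP P * U) j i ^ 2 = (Uᵀ * PP (P * P) * U) i i := by
      have : PP (P * P) = PP P * PP P := by simp [PP, Matrix.fromBlocks_multiply]
      rw [this, ← hsq, Matrix.mul_apply]
      exact Finset.sum_congr rfl fun j _ => by rw [sq, hppsymm i j]
    rw [e, hpp]
    refine (dotProduct_mulVec_le_norm _ _).trans ?_
    rw [(hmass i hi).1]
    have := norm_mul_le P P
    nlinarith
  have hrowQ : ∀ i, h i ≠ 0 → ∑ j, (Uᵀ * QQ Q * U) i j ^ 2 ≤ ‖Q‖ ^ 2 / 2 := by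
    intro i hi
    have e : ∑ j, (Uᵀ * QQ Q * U) i j ^ 2 = (Uᵀ * QQ (Q * Q) * U) i i := by
      have : QQ (Q * Q) = QQ Q * QQ Q := by simp [QQ, Matrix.fromBlocks_multiply]
      rw [this, ← hsq, Matrix.mul_apply]
      exact Finset.sum_congr rfl fun j _ => by rw [sq, hqqsymm j i]
    rw [e, hqq]
    refine (dotProduct_mulVec_le_norm _ _).trans ?_
    rw [(hmass i hi).2]
    have := norm_mul_le Q Q
    nlinarith
  refine ⟨h, Uᵀ * PP P * U, Uᵀ * QQ Q * U, ?_, ?_, ?_, ?_, hppsymm, hqqsymm, ?_, ?_, ?_, ?_, ?_⟩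
  · intro k
    have := trace_mul_conj_diagonal (PP P) U (fun i => h i ^ (2 * k))
    rw [← hpow, dilation_pow_even, Matrix.fromBlocks_multiply, htr] at this
    simpa [pow_mul] using this
  · intro k
    have := trace_mul_conj_diagonal (QQ Q) U (fun i => h i ^ (2 * k))
    rw [← hpow, dilation_pow_even, Matrix.fromBlocks_multiply, htr] at this
    simpa [pow_mul] using this
  · intro k hk
    rw [← trace_dilation_pow_even Z hk]
    have := trace_mul_conj_diagonal 1 U (fun i => h i ^ (2 * k))
    rw [← hpow, Matrix.one_mul, Matrix.mul_one, hU1] at this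
    rw [this]
    simp [pow_mul]
  · intro k l
    have := trace_mul_conj_diagonal_mul_conj_diagonal (QQ Q) (PP P) U
      (fun i => h i ^ (2 * k + 1)) (fun i => h i ^ (2 * l + 1))
    rw [← hpow, ← hpow, dilation_pow_odd, dilation_pow_odd, Matrix.fromBlocks_multiply,
      Matrix.fromBlocks_multiply, Matrix.fromBlocks_multiply, htr] at this
    rw [← this]
    simp [Matrix.transpose_mul, Matrix.transpose_pow, Matrix.mul_assoc]
  · intro i
    rw [hpp]
    simpa using hP.dotProduct_mulVec_nonneg (x i)
  · intro i
    rw [hqq]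
    simpa using hQ.dotProduct_mulVec_nonneg (y i)
  · intro i hi
    rw [hpp]
    refine (dotProduct_mulVec_le_norm _ _).trans ?_
    rw [(hmass i hi).1]; linarith
  · intro i hi
    rw [hqq]
    refine (dotProduct_mulVec_le_norm _ _).trans ?_
    rw [(hmass i hi).2]; linarith
  · intro i hi
    have hcs := Finset.sum_mul_sq_le_sq_mul_sq Finset.univ
      (fun j => |(Uᵀ * QQ Q * U) i j|) (fun j => |(Uᵀ * PP P * U) j i|)
    simp only [sq_abs] at hcs
    have h2 : (∑ j, |(Uᵀ * QQ Q * U) i j| * |(Uᵀ * PP P * U) j i|) ^ 2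
        ≤ (‖P‖ * ‖Q‖ / 2) ^ 2 := by
      refine hcs.trans ((mul_le_mul (hrowQ i hi) (hrowP i hi)
        (Finset.sum_nonneg fun _ _ => sq_nonneg _) (by positivity)).trans_eq ?_)
      ring
    exact le_of_abs_le (abs_le_of_sq_le_sq h2 (by positivity))

end Dilation

/-! ### Trace inequalities and the moment recursion -/

section TraceInequalities

variable {r s : Type*} [Fintype r] [Fintype s] [DecidableEq r] [DecidableEq s]
  (Z : Matrix r s ℝ) {P : Matrix r r ℝ} {Q : Matrix s s ℝ}

lemma trace_left_mul_pow_le (hP : P.PosSemidef) {k : ℕ} (hk : k ≠ 0) :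
    0 ≤ (P * (Z * Zᵀ) ^ k).trace ∧
      (P * (Z * Zᵀ) ^ k).trace ≤ ‖P‖ * ((Z * Zᵀ) ^ k).trace := by
  obtain ⟨h, pp, qq, h1, -, h3, -, -, -, h5, -, h7, -, -⟩ :=
    exists_dilation_coordinates Z hP (Matrix.PosSemidef.zero (n := s))
  refine ⟨h1 k ▸ Finset.sum_nonneg fun i _ => mul_nonneg (h5 i) (by positivity), ?_⟩
  calc _ = ∑ i, pp i i * (h i ^ 2) ^ k := h1 k
    _ ≤ ∑ i, ‖P‖ / 2 * (h i ^ 2) ^ k := by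
      refine Finset.sum_le_sum fun i _ => ?_
      by_cases hi : h i = 0
      · simp [hi, hk]
      · exact mul_le_mul_of_nonneg_right (h7 i hi) (by positivity)
    _ = _ := by rw [← Finset.mul_sum, h3 k hk]; ring

lemma trace_right_mul_pow_le (hQ : Q.PosSemidef) {k : ℕ} (hk : k ≠ 0) :
    0 ≤ (Q * (Zᵀ * Z) ^ k).trace ∧
      (Q * (Zᵀ * Z) ^ k).trace ≤ ‖Q‖ * ((Z * Zᵀ) ^ k).trace := by
  obtain ⟨h, pp, qq, -, h1, h3, -, -, -, -, h5, -, h7, -⟩ :=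
    exists_dilation_coordinates Z (Matrix.PosSemidef.zero (n := r)) hQ
  refine ⟨h1 k ▸ Finset.sum_nonneg fun i _ => mul_nonneg (h5 i) (by positivity), ?_⟩
  calc _ = ∑ i, qq i i * (h i ^ 2) ^ k := h1 k
    _ ≤ ∑ i, ‖Q‖ / 2 * (h i ^ 2) ^ k := by
      refine Finset.sum_le_sum fun i _ => ?_
      by_cases hi : h i = 0
      · simp [hi, hk]
      · exact mul_le_mul_of_nonneg_right (h7 i hi) (by positivity)
    _ = _ := by rw [← Finset.mul_sum, h3 k hk]; ring

omit [DecidableEq s] in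
lemma trace_pow_nonneg (k : ℕ) : 0 ≤ ((Z * Zᵀ) ^ k).trace := by
  have h : (Z * Zᵀ).PosSemidef := by
    simpa [Matrix.conjTranspose_eq_transpose_of_trivial] using
      Matrix.posSemidef_self_mul_conjTranspose Z
  exact (h.pow k).trace_nonneg

/-- The terms in which the two contracted factors are `Z` and `Zᵀ`: Young's inequality turns the
mixed powers into pure ones, at the cost of the average of the two variance parameters. -/
lemma sum_trace_mul_trace_le (hP : P.PosSemidef) (hQ : Q.PosSemidef) {p : ℕ} (hp : p ≠ 0) :
    ∑ k ∈ Finset.range (p + 1), (Q * (Zᵀ * Z) ^ k).trace * (P * (Z * Zᵀ) ^ (p - k)).trace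
      ≤ (p + 1) / 2 * (‖P‖ * Q.trace + ‖Q‖ * P.trace) * ((Z * Zᵀ) ^ p).trace := by
  have hPp := (trace_left_mul_pow_le Z hP hp).2
  have hQp := (trace_right_mul_pow_le Z hQ hp).2
  obtain ⟨h, pp, qq, hp1, hq1, -, -, -, -, hp0, hq0, -, -, -⟩ := exists_dilation_coordinates Z hP hQ
  have hPt : P.trace = ∑ i, pp i i := by simpa using hp1 0
  have hQt : Q.trace = ∑ i, qq i i := by simpa using hq1 0
  have e : ∑ k ∈ Finset.range (p + 1), (Q * (Zᵀ * Z) ^ k).trace * (P * (Z * Zᵀ) ^ (p - k)).trace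
      = ∑ i, ∑ j, qq i i * pp j j *
        ∑ k ∈ Finset.range (p + 1), (h i ^ 2) ^ k * (h j ^ 2) ^ (p - k) := by
    simp_rw [hp1, hq1, Finset.sum_mul_sum, Finset.mul_sum]
    rw [Finset.sum_comm]
    refine Finset.sum_congr rfl fun i _ => ?_
    rw [Finset.sum_comm]
    refine Finset.sum_congr rfl fun j _ => Finset.sum_congr rfl fun k _ => by ring
  rw [e]
  calc _ ≤ ∑ i, ∑ j, qq i i * pp j j * ((p + 1) / 2 * ((h i ^ 2) ^ p + (h j ^ 2) ^ p)) :=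
        Finset.sum_le_sum fun i _ => Finset.sum_le_sum fun j _ =>
          mul_le_mul_of_nonneg_left (sum_pow_mul_pow_le (sq_nonneg _) (sq_nonneg _) p)
            (mul_nonneg (hq0 i) (hp0 j))
    _ = (p + 1) / 2 * ((∑ i, qq i i * (h i ^ 2) ^ p) * ∑ j, pp j j
          + (∑ i, qq i i) * ∑ j, pp j j * (h j ^ 2) ^ p) := by
        simp_rw [Finset.sum_mul_sum, ← Finset.sum_add_distrib, Finset.mul_sum]
        exact Finset.sum_congr rfl fun i _ => Finset.sum_congr rfl fun j _ => by ring
    _ = (p + 1) / 2 * ((Q * (Zᵀ * Z) ^ p).trace * P.trace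
          + Q.trace * (P * (Z * Zᵀ) ^ p).trace) := by rw [hp1, hq1, hPt, hQt]
    _ ≤ (p + 1) / 2 * (‖Q‖ * ((Z * Zᵀ) ^ p).trace * P.trace
          + Q.trace * (‖P‖ * ((Z * Zᵀ) ^ p).trace)) := by
        have := hP.trace_nonneg
        have := hQ.trace_nonneg
        gcongr
    _ = _ := by ring

/-- The terms in which the two contracted factors are both `Z`: Young's inequality again yields pure
powers, and Cauchy-Schwarz bounds the remaining sums over matrix entries of `P` and `Q`. -/
lemma sum_trace_cross_le (hP : P.PosSemidef) (hQ : Q.PosSemidef) (p : ℕ) :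
    ∑ k ∈ Finset.range p, (Q * ((Zᵀ * Z) ^ k * Zᵀ) * P * (Zᵀ * (Z * Zᵀ) ^ (p - 1 - k))ᵀ).trace
      ≤ p * (‖P‖ * ‖Q‖) * ((Z * Zᵀ) ^ p).trace := by
  rcases Nat.eq_zero_or_pos p with rfl | hp
  · simp
  obtain ⟨p, rfl⟩ := Nat.exists_eq_succ_of_ne_zero hp.ne'
  obtain ⟨h, pp, qq, -, -, htr, hcr, hps, hqs, -, -, -, -, hrow⟩ :=
    exists_dilation_coordinates Z hP hQ
  simp only [Nat.succ_eq_add_one, Nat.add_sub_cancel]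
  have e : ∑ k ∈ Finset.range (p + 1),
        (Q * ((Zᵀ * Z) ^ k * Zᵀ) * P * (Zᵀ * (Z * Zᵀ) ^ (p - k))ᵀ).trace
      = ∑ i, ∑ j, qq i j * pp j i * (h i * h j) *
        ∑ k ∈ Finset.range (p + 1), (h j ^ 2) ^ k * (h i ^ 2) ^ (p - k) := by
    simp_rw [hcr, Finset.mul_sum]
    rw [Finset.sum_comm]
    refine Finset.sum_congr rfl fun i _ => ?_
    rw [Finset.sum_comm]
    refine Finset.sum_congr rfl fun j _ => Finset.sum_congr rfl fun k _ => ?_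
    rw [pow_succ, pow_succ, pow_mul, pow_mul]; ring
  rw [e]
  have hterm : ∀ i j, qq i j * pp j i * (h i * h j) *
        ∑ k ∈ Finset.range (p + 1), (h j ^ 2) ^ k * (h i ^ 2) ^ (p - k)
      ≤ (p + 1) / 2 * (|qq i j| * |pp j i| * (h i ^ 2) ^ (p + 1))
        + (p + 1) / 2 * (|qq j i| * |pp i j| * (h j ^ 2) ^ (p + 1)) := by
    intro i j
    rw [hps i j, hqs j i]
    have h1 := sum_pow_mul_pow_le (sq_nonneg (h j)) (sq_nonneg (h i)) p
    have h2 := abs_mul_abs_mul_add_pow_le (h j) (h i) p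
    have h0 : 0 ≤ ∑ k ∈ Finset.range (p + 1), (h j ^ 2) ^ k * (h i ^ 2) ^ (p - k) :=
      Finset.sum_nonneg fun k _ => by positivity
    have h3 : qq i j * pp j i * (h i * h j) ≤ |qq i j| * |pp j i| * (|h j| * |h i|) := by
      refine (le_abs_self _).trans_eq ?_
      rw [abs_mul, abs_mul, abs_mul]; ring
    calc _ ≤ |qq i j| * |pp j i| * (|h j| * |h i|)
          * ((p + 1) / 2 * ((h j ^ 2) ^ p + (h i ^ 2) ^ p)) := mul_le_mul h3 h1 h0 (by positivity)
      _ = |qq i j| * |pp j i| * ((p + 1) / 2)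
          * (|h j| * |h i| * ((h j ^ 2) ^ p + (h i ^ 2) ^ p)) := by ring
      _ ≤ |qq i j| * |pp j i| * ((p + 1) / 2)
          * ((h j ^ 2) ^ (p + 1) + (h i ^ 2) ^ (p + 1)) := by gcongr
      _ = _ := by ring
  have hsum : ∑ i, ∑ j, |qq i j| * |pp j i| * (h i ^ 2) ^ (p + 1)
      ≤ ‖P‖ * ‖Q‖ * ((Z * Zᵀ) ^ (p + 1)).trace := by
    calc _ ≤ ∑ i, ‖P‖ * ‖Q‖ / 2 * (h i ^ 2) ^ (p + 1) := by
          refine Finset.sum_le_sum fun i _ => ?_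
          rw [← Finset.sum_mul]
          by_cases hi : h i = 0
          · simp [hi]
          · exact mul_le_mul_of_nonneg_right (hrow i hi) (by positivity)
      _ = _ := by rw [← Finset.mul_sum, htr _ p.succ_ne_zero]; ring
  calc _ ≤ ∑ i, ∑ j, ((p + 1) / 2 * (|qq i j| * |pp j i| * (h i ^ 2) ^ (p + 1))
        + (p + 1) / 2 * (|qq j i| * |pp i j| * (h j ^ 2) ^ (p + 1))) :=
        Finset.sum_le_sum fun i _ => Finset.sum_le_sum fun j _ => hterm i j
    _ = (p + 1) * ∑ i, ∑ j, |qq i j| * |pp j i| * (h i ^ 2) ^ (p + 1) := by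
        simp_rw [Finset.sum_add_distrib]
        rw [Finset.sum_comm (f := fun i j =>
          ((p : ℝ) + 1) / 2 * (|qq j i| * |pp i j| * (h j ^ 2) ^ (p + 1)))]
        simp_rw [← Finset.mul_sum]
        ring
    _ ≤ (p + 1) * (‖P‖ * ‖Q‖ * ((Z * Zᵀ) ^ (p + 1)).trace) := by gcongr
    _ = _ := by push_cast; ring

end TraceInequalities

section MomentBounds

variable {m n r s : Type*} [Fintype m] [Fintype n] [DecidableEq m] [DecidableEq n]
  [Fintype r] [Fintype s] [DecidableEq r] [DecidableEq s] (A : Matrix r m ℝ) (B : Matrix n s ℝ)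

/-- The moments `E tr (Z Zᵀ) ^ p` of the Gaussian matrix `Z = A X B`. -/
noncomputable def traceMoment (p : ℕ) : ℝ :=
  ∫ x, ((gaussMatrix A B x * (gaussMatrix A B x)ᵀ) ^ p).trace ∂(gaussPi (m × n))

omit [DecidableEq m] [DecidableEq r] in
lemma posSemidef_mul_transpose : (A * Aᵀ).PosSemidef := by
  simpa [Matrix.conjTranspose_eq_transpose_of_trivial] using
    Matrix.posSemidef_self_mul_conjTranspose A

omit [DecidableEq n] [DecidableEq s] in
lemma posSemidef_transpose_mul : (Bᵀ * B).PosSemidef := by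
  simpa [Matrix.conjTranspose_eq_transpose_of_trivial] using
    Matrix.posSemidef_conjTranspose_mul_self B

omit [DecidableEq m] [DecidableEq n] [DecidableEq s] in
lemma traceMoment_nonneg (p : ℕ) : 0 ≤ traceMoment A B p :=
  integral_nonneg fun _ => trace_pow_nonneg _ p

lemma traceMoment_one : traceMoment A B 1 = (A * Aᵀ).trace * (Bᵀ * B).trace := by
  rw [traceMoment, integral_trace_pow_succ]
  simp [traceContraction, mul_comm]

/-- The moment recursion: if both variance parameters are at most `L` and `v = ‖A Aᵀ‖ ‖Bᵀ B‖`, the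
factor is at most `(p + 1) L + p v`. -/
lemma traceMoment_succ_le {p : ℕ} (hp : p ≠ 0) :
    traceMoment A B (p + 1)
      ≤ ((p + 1) / 2 * (‖A * Aᵀ‖ * (Bᵀ * B).trace + ‖Bᵀ * B‖ * (A * Aᵀ).trace)
        + p * (‖A * Aᵀ‖ * ‖Bᵀ * B‖)) * traceMoment A B p := by
  rw [traceMoment, integral_trace_pow_succ, traceMoment, ← integral_const_mul]
  refine integral_mono (integrable_traceContraction A B p)
    ((integrable_trace_pow_gaussMatrix A B p).const_mul _) fun x => ?_
  have h1 := sum_trace_mul_trace_le (gaussMatrix A B x) (posSemidef_mul_transpose A)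
    (posSemidef_transpose_mul B) hp
  have h2 := sum_trace_cross_le (gaussMatrix A B x) (posSemidef_mul_transpose A)
    (posSemidef_transpose_mul B) p
  simp only [traceContraction]
  linarith

lemma integral_sq_trace_le :
    ∫ x, (gaussMatrix A B x * (gaussMatrix A B x)ᵀ).trace ^ 2 ∂(gaussPi (m × n))
      ≤ ((A * Aᵀ).trace * (Bᵀ * B).trace + 2 * (‖A * Aᵀ‖ * ‖Bᵀ * B‖)) * traceMoment A B 1 := by
  have hint := integrable_trace_pow_gaussMatrix A B 1
  rw [integral_sq_trace, traceMoment, ← integral_const_mul]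
  refine integral_mono_of_nonneg (Filter.Eventually.of_forall fun x => ?_) (hint.const_mul _)
    (Filter.Eventually.of_forall fun x => ?_)
  · set Z := gaussMatrix A B x
    have h1 : (Bᵀ * B * Zᵀ * (A * Aᵀ) * Z).trace = ((B * Zᵀ * A) * (B * Zᵀ * A)ᵀ).trace := by
      rw [Matrix.mul_assoc Bᵀ, Matrix.mul_assoc Bᵀ, Matrix.mul_assoc Bᵀ, Matrix.trace_mul_comm]
      simp only [Matrix.transpose_mul, Matrix.transpose_transpose, Matrix.mul_assoc]
    have h2 : 0 ≤ (Z * Zᵀ).trace := (posSemidef_mul_transpose Z).trace_nonneg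
    have h3 := (posSemidef_mul_transpose (B * Zᵀ * A)).trace_nonneg
    have h4 := (posSemidef_mul_transpose A).trace_nonneg
    have h5 := (posSemidef_transpose_mul B).trace_nonneg
    exact add_nonneg (mul_nonneg (mul_nonneg h5 h4) h2)
      (mul_nonneg zero_le_two (h3.trans_eq h1.symm))
  · have h2 := sum_trace_cross_le (gaussMatrix A B x) (posSemidef_mul_transpose A)
      (posSemidef_transpose_mul B) 1
    simp only [Finset.range_one, Finset.sum_singleton, pow_zero, Nat.sub_self, Matrix.mul_one,
      Matrix.transpose_transpose, Nat.cast_one, one_mul, ← Matrix.mul_assoc] at h2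
    simp only [pow_one, ← Matrix.mul_assoc] at h2 ⊢
    linarith

/-- The third moment, with the middle term of the contraction estimated by `E (tr Z Zᵀ) ^ 2`. -/
lemma traceMoment_three_le :
    traceMoment A B 3
      ≤ (‖A * Aᵀ‖ * (Bᵀ * B).trace + ‖Bᵀ * B‖ * (A * Aᵀ).trace
          + 2 * (‖A * Aᵀ‖ * ‖Bᵀ * B‖)) * traceMoment A B 2
        + ‖A * Aᵀ‖ * ‖Bᵀ * B‖ *
          (((A * Aᵀ).trace * (Bᵀ * B).trace + 2 * (‖A * Aᵀ‖ * ‖Bᵀ * B‖)) *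
            ((A * Aᵀ).trace * (Bᵀ * B).trace)) := by
  have hmain : traceMoment A B 3
      ≤ (‖A * Aᵀ‖ * (Bᵀ * B).trace + ‖Bᵀ * B‖ * (A * Aᵀ).trace
          + 2 * (‖A * Aᵀ‖ * ‖Bᵀ * B‖)) * traceMoment A B 2
        + ‖A * Aᵀ‖ * ‖Bᵀ * B‖ *
          ∫ x, (gaussMatrix A B x * (gaussMatrix A B x)ᵀ).trace ^ 2 ∂(gaussPi (m × n)) := by
    rw [traceMoment, integral_trace_pow_succ, traceMoment, ← integral_const_mul,
      ← integral_const_mul, ← integral_add ((integrable_trace_pow_gaussMatrix A B 2).const_mul _)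
      ((integrable_sq_trace_gaussMatrix A B).const_mul _)]
    refine integral_mono (integrable_traceContraction A B 2)
      (((integrable_trace_pow_gaussMatrix A B 2).const_mul _).add
        ((integrable_sq_trace_gaussMatrix A B).const_mul _)) fun x => ?_
    set Z := gaussMatrix A B x
    have hP := posSemidef_mul_transpose A
    have hQ := posSemidef_transpose_mul B
    have h2 := sum_trace_cross_le Z hP hQ 2
    have p1 := trace_left_mul_pow_le Z hP one_ne_zero
    have q1 := trace_right_mul_pow_le Z hQ one_ne_zero
    have p2 := trace_left_mul_pow_le Z hP two_ne_zero
    have q2 := trace_right_mul_pow_le Z hQ two_ne_zero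
    have m1 := mul_le_mul q1.2 p1.2 p1.1 (mul_nonneg (norm_nonneg _) (trace_pow_nonneg Z 1))
    have m2 := mul_le_mul_of_nonneg_left p2.2 hQ.trace_nonneg
    have m3 := mul_le_mul_of_nonneg_right q2.2 hP.trace_nonneg
    simp only [traceContraction]
    rw [Finset.sum_range_succ, Finset.sum_range_succ, Finset.sum_range_one]
    simp only [pow_zero, Matrix.mul_one, Nat.sub_zero, Nat.sub_self, Nat.reduceSub]
    simp only [pow_one] at m1 ⊢
    push_cast at h2
    linarith
  refine hmain.trans ?_
  have h := integral_sq_trace_le A B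
  rw [traceMoment_one] at h
  gcongr

end MomentBounds

/-! ### From trace moments to tail bounds -/

section NormTrace

variable {r s : Type*} [Fintype r] [Fintype s] [DecidableEq r] [DecidableEq s]

lemma norm_le_one_of_transpose_mul_self {U : Matrix r r ℝ} (hU : Uᵀ * U = 1) : ‖U‖ ≤ 1 := by
  have h := Matrix.l2_opNorm_conjTranspose_mul_self U
  rw [Matrix.conjTranspose_eq_transpose_of_trivial, hU] at h
  have h1 : ‖(1 : Matrix r r ℝ)‖ ≤ 1 := by
    rw [← Matrix.diagonal_one, Matrix.l2_opNorm_diagonal]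
    exact (pi_norm_le_iff_of_nonneg zero_le_one).2 fun i => by simp
  nlinarith [norm_nonneg U]

lemma Matrix.PosSemidef.norm_pow_le_trace_pow {W : Matrix r r ℝ} (hW : W.PosSemidef) {p : ℕ}
    (hp : p ≠ 0) : ‖W‖ ^ p ≤ (W ^ p).trace := by
  obtain ⟨U, d, h1, h2, hpow⟩ := hW.isHermitian.exists_orthogonal_diagonalization
  have hW1 : W = U * Matrix.diagonal d * Uᵀ := by simpa using hpow 1
  have hd : ∀ i, 0 ≤ d i := by
    intro i
    have hD : Uᵀ * W * U = Matrix.diagonal d := by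
      rw [hW1]
      calc Uᵀ * (U * Matrix.diagonal d * Uᵀ) * U
          = (Uᵀ * U) * Matrix.diagonal d * (Uᵀ * U) := by simp only [Matrix.mul_assoc]
        _ = _ := by rw [h1, Matrix.one_mul, Matrix.mul_one]
    have h := hW.conjTranspose_mul_mul_same U
    rw [Matrix.conjTranspose_eq_transpose_of_trivial, hD] at h
    simpa using h.diag_nonneg (i := i)
  have htr : (W ^ p).trace = ∑ i, d i ^ p := by
    rw [hpow, Matrix.mul_assoc, Matrix.trace_mul_comm, Matrix.mul_assoc, h1, Matrix.mul_one]
    simp [Matrix.trace]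
  have hsum : 0 ≤ ∑ i, d i ^ p := Finset.sum_nonneg fun i _ => pow_nonneg (hd i) p
  have hnorm : ‖W‖ ≤ ‖d‖ := by
    have hU := norm_le_one_of_transpose_mul_self h1
    have hUt : ‖Uᵀ‖ ≤ 1 := norm_le_one_of_transpose_mul_self (by simpa using h2)
    calc ‖W‖ ≤ ‖U‖ * ‖Matrix.diagonal d‖ * ‖Uᵀ‖ := by
          rw [hW1]
          exact (norm_mul_le _ _).trans (by gcongr; exact norm_mul_le _ _)
      _ ≤ 1 * ‖d‖ * 1 := by
          rw [Matrix.l2_opNorm_diagonal]; gcongr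
      _ = ‖d‖ := by ring
  have hdn : ‖d‖ ≤ (∑ i, d i ^ p) ^ ((p : ℝ)⁻¹) := by
    refine (pi_norm_le_iff_of_nonneg (by positivity)).2 fun i => ?_
    rw [Real.norm_of_nonneg (hd i), Real.le_rpow_inv_iff_of_pos (hd i) hsum (by positivity),
      Real.rpow_natCast]
    exact Finset.single_le_sum (f := fun i => d i ^ p) (fun i _ => pow_nonneg (hd i) p)
      (Finset.mem_univ i)
  calc ‖W‖ ^ p ≤ ((∑ i, d i ^ p) ^ ((p : ℝ)⁻¹)) ^ p := by
        gcongr; exact hnorm.trans hdn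
    _ = _ := by rw [Real.rpow_inv_natCast_pow hsum hp, htr]

lemma norm_sq_eq_norm_mul_transpose (Z : Matrix r s ℝ) : ‖Z‖ ^ 2 = ‖Z * Zᵀ‖ := by
  have h := Matrix.l2_opNorm_conjTranspose_mul_self Zᵀ
  rw [Matrix.conjTranspose_eq_transpose_of_trivial, Matrix.transpose_transpose] at h
  have h2 := Matrix.l2_opNorm_conjTranspose Z
  rw [Matrix.conjTranspose_eq_transpose_of_trivial] at h2
  rw [h, h2, sq]

lemma norm_pow_le_trace_pow (Z : Matrix r s ℝ) {p : ℕ} (hp : p ≠ 0) :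
    (‖Z‖ ^ 2) ^ p ≤ ((Z * Zᵀ) ^ p).trace := by
  rw [norm_sq_eq_norm_mul_transpose]
  exact (posSemidef_mul_transpose Z).norm_pow_le_trace_pow hp

lemma trace_le_card_mul_norm (W : Matrix r r ℝ) : W.trace ≤ Fintype.card r * ‖W‖ := by
  have h : ∀ i, W i i ≤ ‖W‖ := fun i => by
    simpa using dotProduct_mulVec_le_norm W (Pi.single i 1)
  calc W.trace = ∑ i, W i i := rfl
    _ ≤ ∑ _i : r, ‖W‖ := Finset.sum_le_sum fun i _ => h i
    _ = _ := by simp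

end NormTrace

section Tail

variable {m n r s : Type*} [Fintype m] [Fintype n] [DecidableEq m] [DecidableEq n]
  [Fintype r] [Fintype s] [DecidableEq r] [DecidableEq s] (A : Matrix r m ℝ) (B : Matrix n s ℝ)

/-- `P[‖A X B‖ ≥ t]` for a matrix `X` with independent standard Gaussian entries. -/
noncomputable def gaussTail (t : ℝ) : ℝ :=
  (gaussPi (m × n)).real {x | t ≤ ‖gaussMatrix A B x‖}

omit [DecidableEq m] [DecidableEq n] in
/-- Markov's inequality for the `p`-th trace moment. -/
lemma gaussTail_mul_pow_le {t : ℝ} (ht : 0 ≤ t) {p : ℕ} (hp : p ≠ 0) :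
    gaussTail A B t * (t ^ 2) ^ p ≤ traceMoment A B p := by
  have h := mul_meas_ge_le_integral_of_nonneg (μ := gaussPi (m × n))
    (f := fun x => ((gaussMatrix A B x * (gaussMatrix A B x)ᵀ) ^ p).trace)
    (Filter.Eventually.of_forall fun x => trace_pow_nonneg _ p)
    (integrable_trace_pow_gaussMatrix A B p) ((t ^ 2) ^ p)
  refine le_trans ?_ h
  rw [mul_comm]
  refine mul_le_mul_of_nonneg_left ?_ (by positivity)
  refine measureReal_mono fun x hx => ?_
  simp only [Set.mem_ofPred_eq] at hx ⊢
  refine le_trans ?_ (norm_pow_le_trace_pow _ hp)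
  gcongr

/-- The odd double factorial `1 · 3 ⋯ (2 p - 1)`. -/
noncomputable def oddFactorial (p : ℕ) : ℝ := ∏ k ∈ Finset.range p, (2 * k + 1 : ℝ)

lemma oddFactorial_succ (p : ℕ) : oddFactorial (p + 1) = oddFactorial p * (2 * p + 1) :=
  Finset.prod_range_succ _ _

lemma oddFactorial_pos (p : ℕ) : 0 < oddFactorial p :=
  Finset.prod_pos fun _ _ => by positivity

variable {A B} {v L : ℝ}

omit [DecidableEq m] [DecidableEq n] in
lemma trace_mul_trace_le (hv : v = ‖A * Aᵀ‖ * ‖Bᵀ * B‖) (hv0 : 0 < v)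
    (hA : (A * Aᵀ).trace * ‖Bᵀ * B‖ ≤ L) (hB : (Bᵀ * B).trace * ‖A * Aᵀ‖ ≤ L) :
    (A * Aᵀ).trace * (Bᵀ * B).trace ≤ L ^ 2 / v := by
  rw [le_div_iff₀ hv0, hv, sq]
  have h4 := (posSemidef_mul_transpose A).trace_nonneg
  have h5 := (posSemidef_transpose_mul B).trace_nonneg
  have h6 : 0 ≤ (A * Aᵀ).trace * ‖Bᵀ * B‖ := by positivity
  calc _ = ((A * Aᵀ).trace * ‖Bᵀ * B‖) * ((Bᵀ * B).trace * ‖A * Aᵀ‖) := by ring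
    _ ≤ L * L := mul_le_mul hA hB (by positivity) (h6.trans hA)

lemma traceMoment_two_le (hv : v = ‖A * Aᵀ‖ * ‖Bᵀ * B‖) (hv0 : 0 < v)
    (hA : (A * Aᵀ).trace * ‖Bᵀ * B‖ ≤ L) (hB : (Bᵀ * B).trace * ‖A * Aᵀ‖ ≤ L) :
    traceMoment A B 2 ≤ (2 * L + v) * (L ^ 2 / v) := by
  have h := traceMoment_succ_le A B one_ne_zero
  rw [traceMoment_one, ← hv] at h
  have h1 := trace_mul_trace_le hv hv0 hA hB
  have h4 := (posSemidef_mul_transpose A).trace_nonneg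
  have h5 := (posSemidef_transpose_mul B).trace_nonneg
  refine h.trans (mul_le_mul ?_ h1 (by positivity) ?_)
  · push_cast; linarith
  · have h6 : 0 ≤ (A * Aᵀ).trace * ‖Bᵀ * B‖ := by positivity
    linarith

lemma traceMoment_three_le_of_le (hv : v = ‖A * Aᵀ‖ * ‖Bᵀ * B‖) (hv0 : 0 < v)
    (hA : (A * Aᵀ).trace * ‖Bᵀ * B‖ ≤ L) (hB : (Bᵀ * B).trace * ‖A * Aᵀ‖ ≤ L) :
    traceMoment A B 3 ≤ (2 * L + 2 * v) * ((2 * L + v) * (L ^ 2 / v))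
      + v * ((L ^ 2 / v + 2 * v) * (L ^ 2 / v)) := by
  have h := traceMoment_three_le A B
  rw [← hv] at h
  have h1 := trace_mul_trace_le hv hv0 hA hB
  have h2 := traceMoment_two_le hv hv0 hA hB
  have h4 := (posSemidef_mul_transpose A).trace_nonneg
  have h5 := (posSemidef_transpose_mul B).trace_nonneg
  have h6 : 0 ≤ (A * Aᵀ).trace * ‖Bᵀ * B‖ := by positivity
  refine h.trans (add_le_add (mul_le_mul ?_ h2 (traceMoment_nonneg A B 2) ?_) ?_)
  · linarith
  · linarith
  · gcongr

/-- The third moment polynomial in the intrinsic dimension `ℓ = L / v`. -/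
noncomputable def cubicMoment (l : ℝ) : ℝ := 5 * l + 6 + 4 / l

/-- From the third moment on, bounding the recursion factor by `(2 p + 1) L` loses little. -/
lemma traceMoment_le_oddFactorial (hv : v = ‖A * Aᵀ‖ * ‖Bᵀ * B‖) (hv0 : 0 < v) (hvL : v ≤ L)
    (hA : (A * Aᵀ).trace * ‖Bᵀ * B‖ ≤ L) (hB : (Bᵀ * B).trace * ‖A * Aᵀ‖ ≤ L) {p : ℕ}
    (hp : 3 ≤ p) :
    traceMoment A B p ≤ L ^ p * (cubicMoment (L / v) / 15 * oddFactorial p) := by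
  have hL : 0 < L := hv0.trans_le hvL
  induction p, hp using Nat.le_induction with
  | base =>
    refine (traceMoment_three_le_of_le hv hv0 hA hB).trans_eq ?_
    simp only [oddFactorial, cubicMoment, Finset.prod_range_succ, Finset.prod_range_zero]
    field_simp
    push_cast
    ring
  | succ p hp ih =>
    have h := traceMoment_succ_le A B (p := p) (by omega)
    rw [← hv] at h
    have h6 : (p + 1) / 2 * (‖A * Aᵀ‖ * (Bᵀ * B).trace + ‖Bᵀ * B‖ * (A * Aᵀ).trace)
        + p * v ≤ (2 * p + 1) * L := by
      have : ‖A * Aᵀ‖ * (Bᵀ * B).trace + ‖Bᵀ * B‖ * (A * Aᵀ).trace ≤ 2 * L := by linarith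
      calc _ ≤ ((p : ℝ) + 1) / 2 * (2 * L) + p * L := by gcongr
        _ = _ := by ring
    calc _ ≤ (2 * p + 1) * L * (L ^ p * (cubicMoment (L / v) / 15 * oddFactorial p)) :=
          h.trans (mul_le_mul h6 ih (traceMoment_nonneg A B p) (by positivity))
      _ = _ := by rw [oddFactorial_succ]; ring

/-- Markov bounds for the tail from all trace moments, in the variables `x = t² / L` and
`ℓ = L / v`. -/
lemma gaussTail_moment_bounds (hv : v = ‖A * Aᵀ‖ * ‖Bᵀ * B‖) (hv0 : 0 < v) (hvL : v ≤ L)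
    (hA : (A * Aᵀ).trace * ‖Bᵀ * B‖ ≤ L) (hB : (Bᵀ * B).trace * ‖A * Aᵀ‖ ≤ L) {t : ℝ}
    (ht : 0 ≤ t) :
    gaussTail A B t * (t ^ 2 / L) ≤ L / v ∧
    gaussTail A B t * (t ^ 2 / L) ^ 2 ≤ 2 * (L / v) + 1 ∧
    ∀ p, 3 ≤ p →
      gaussTail A B t * (t ^ 2 / L) ^ p ≤ cubicMoment (L / v) / 15 * oddFactorial p := by
  have hL : 0 < L := hv0.trans_le hvL
  refine ⟨?_, ?_, fun p hp => ?_⟩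
  · have h := gaussTail_mul_pow_le A B ht one_ne_zero
    rw [traceMoment_one, pow_one] at h
    have h2 := h.trans (trace_mul_trace_le hv hv0 hA hB)
    rw [← mul_div_assoc, div_le_iff₀ hL]
    exact h2.trans_eq (by ring)
  · have h2 := (gaussTail_mul_pow_le A B ht two_ne_zero).trans (traceMoment_two_le hv hv0 hA hB)
    rw [div_pow, ← mul_div_assoc, div_le_iff₀ (by positivity)]
    exact h2.trans_eq (by field_simp)
  · have h2 := (gaussTail_mul_pow_le A B ht (by omega : p ≠ 0)).trans
      (traceMoment_le_oddFactorial hv hv0 hvL hA hB hp)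
    rw [div_pow, ← mul_div_assoc, div_le_iff₀ (by positivity)]
    exact h2.trans_eq (by ring)

end Tail

/-! ### Tails of the chi-squared distribution -/

section RadialIntegral

/-- The radial integral `∫_r^∞ y ^ k exp (-y² / 2) dy`. -/
noncomputable def radialTail (k : ℕ) (r : ℝ) : ℝ :=
  ∫ y in Set.Ioi r, y ^ k * Real.exp (-(1 / 2) * y ^ 2)

lemma integrable_pow_mul_exp (k : ℕ) :
    Integrable (fun y : ℝ => y ^ k * Real.exp (-(1 / 2) * y ^ 2)) := by
  have h := integrable_rpow_mul_exp_neg_mul_sq (b := 1 / 2) (by norm_num) (s := k)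
      (by have : (0 : ℝ) ≤ k := k.cast_nonneg
          linarith)
  simpa only [Real.rpow_natCast] using h

lemma tendsto_pow_mul_exp (k : ℕ) :
    Filter.Tendsto (fun y : ℝ => y ^ k * Real.exp (-(1 / 2) * y ^ 2)) Filter.atTop (nhds 0) := by
  have h := (tendsto_rpow_abs_mul_exp_neg_mul_sq_cocompact (a := 1 / 2) (by norm_num) k).mono_left
    atTop_le_cocompact
  refine h.congr' ?_
  filter_upwards [Filter.eventually_ge_atTop 0] with y hy
  rw [abs_of_nonneg hy, Real.rpow_natCast]

lemma hasDerivAt_exp_neg_half_sq (y : ℝ) :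
    HasDerivAt (fun y : ℝ => Real.exp (-(1 / 2) * y ^ 2)) (-y * Real.exp (-(1 / 2) * y ^ 2)) y := by
  have h2 : HasDerivAt (fun x : ℝ => x ^ 2) (2 * y) y := by simpa using hasDerivAt_pow 2 y
  convert (h2.const_mul (-(1 / 2))).exp using 1
  ring

lemma radialTail_one (r : ℝ) : radialTail 1 r = Real.exp (-(1 / 2) * r ^ 2) := by
  have h := integral_Ioi_of_hasDerivAt_of_tendsto' (a := r) (m := 0)
    (fun y _ => (hasDerivAt_exp_neg_half_sq y).neg)
    ((integrable_pow_mul_exp 1).integrableOn.congr_fun (fun y _ => by ring) measurableSet_Ioi)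
    (by simpa [Pi.neg_def] using (tendsto_pow_mul_exp 0).neg)
  rw [radialTail]
  simp only [pow_one] at h ⊢
  simpa using h

lemma radialTail_add_two (k : ℕ) (r : ℝ) :
    radialTail (k + 2) r
      = r ^ (k + 1) * Real.exp (-(1 / 2) * r ^ 2) + (k + 1) * radialTail k r := by
  have hd : ∀ y ∈ Set.Ici r, HasDerivAt (fun y : ℝ => y ^ (k + 1) * Real.exp (-(1 / 2) * y ^ 2))
      ((k + 1) * (y ^ k * Real.exp (-(1 / 2) * y ^ 2))
        - y ^ (k + 2) * Real.exp (-(1 / 2) * y ^ 2)) y := by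
    intro y _
    refine ((hasDerivAt_pow (k + 1) y).mul (hasDerivAt_exp_neg_half_sq y)).congr_deriv ?_
    rw [Nat.add_sub_cancel]
    push_cast
    ring
  have i1 := ((integrable_pow_mul_exp k).const_mul (k + 1 : ℝ)).integrableOn (s := Set.Ioi r)
  have i2 := (integrable_pow_mul_exp (k + 2)).integrableOn (s := Set.Ioi r)
  have h := integral_Ioi_of_hasDerivAt_of_tendsto' hd (i1.sub i2) (tendsto_pow_mul_exp (k + 1))
  rw [integral_sub i1 i2, integral_const_mul] at h
  simp only [radialTail]
  linarith

/-- The tail of a chi-squared variable with an even number of degrees of freedom is a Poisson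
probability; `2 ^ k * k!` is the total radial mass. -/
lemma radialTail_odd (k : ℕ) (r : ℝ) :
    radialTail (2 * k + 1) r = 2 ^ k * k.factorial * (Real.exp (-(r ^ 2 / 2))
      * ∑ j ∈ Finset.range (k + 1), (r ^ 2 / 2) ^ j / j.factorial) := by
  have e : -(1 / 2) * r ^ 2 = -(r ^ 2 / 2) := by ring
  induction k with
  | zero => rw [mul_zero, zero_add, radialTail_one, e]; simp
  | succ k ih =>
    rw [show 2 * (k + 1) + 1 = 2 * k + 1 + 2 by ring, radialTail_add_two, ih,
      Finset.sum_range_succ _ (k + 1), e, show 2 * k + 1 + 1 = 2 * (k + 1) by ring, pow_mul,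
      div_pow, Nat.factorial_succ]
    have : (k.factorial : ℝ) ≠ 0 := by positivity
    push_cast
    field_simp
    ring

lemma radialTail_zero_zero : radialTail 0 0 = √(Real.pi / 2) := by
  simp only [radialTail, pow_zero, one_mul]
  rw [integral_gaussian_Ioi, show Real.pi / (1 / 2) = 2 ^ 2 * (Real.pi / 2) by ring,
    Real.sqrt_mul (by norm_num), Real.sqrt_sq (by norm_num)]
  ring

lemma radialTail_zero_le {r : ℝ} (hr : 0 ≤ r) :
    radialTail 0 r ≤ radialTail 0 0 * Real.exp (-(r ^ 2 / 2)) := by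
  have h := (measurePreserving_add_right volume r).setIntegral_preimage_emb
    (measurableEmbedding_addRight r) (fun y : ℝ => y ^ 0 * Real.exp (-(1 / 2) * y ^ 2)) (Set.Ioi r)
  rw [Set.preimage_add_const_Ioi, sub_self] at h
  rw [radialTail, ← h, radialTail, ← integral_mul_const]
  refine setIntegral_mono_on ((integrable_pow_mul_exp 0).comp_add_right r).integrableOn
    ((integrable_pow_mul_exp 0).mul_const _).integrableOn measurableSet_Ioi fun y hy => ?_
  have hy0 : 0 < y := hy
  rw [pow_zero, pow_zero, one_mul, one_mul, ← Real.exp_add]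
  refine Real.exp_le_exp.mpr ?_
  nlinarith [mul_nonneg hy0.le hr]

lemma radialTail_eight_zero : radialTail 8 0 = 105 * √(Real.pi / 2) := by
  rw [radialTail_add_two, radialTail_add_two, radialTail_add_two, radialTail_add_two,
    radialTail_zero_zero]
  norm_num
  ring

/-- Comparison with the two neighbouring exponents, from `y ≤ (y ^ 2 / c + c) / 2`. -/
lemma radialTail_succ_le {k : ℕ} {r c : ℝ} (hr : 0 ≤ r) (hc : 0 < c) :
    radialTail (k + 1) r ≤ (radialTail (k + 2) r / c + c * radialTail k r) / 2 := by
  have i0 := (integrable_pow_mul_exp k).integrableOn (s := Set.Ioi r)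
  have i1 := (integrable_pow_mul_exp (k + 1)).integrableOn (s := Set.Ioi r)
  have i2 := (integrable_pow_mul_exp (k + 2)).integrableOn (s := Set.Ioi r)
  have e : (radialTail (k + 2) r / c + c * radialTail k r) / 2
      = ∫ y in Set.Ioi r, ((1 / (2 * c)) * (y ^ (k + 2) * Real.exp (-(1 / 2) * y ^ 2))
        + (c / 2) * (y ^ k * Real.exp (-(1 / 2) * y ^ 2))) := by
    rw [integral_add (i2.const_mul _) (i0.const_mul _), integral_const_mul, integral_const_mul]
    simp only [radialTail]
    field_simp
  rw [e, radialTail]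
  refine setIntegral_mono_on i1 ((i2.const_mul _).add (i0.const_mul _)) measurableSet_Ioi
    fun y hy => ?_
  have hy0 : 0 ≤ y := hr.trans (le_of_lt hy)
  have h1 : y ≤ (1 / (2 * c)) * y ^ 2 + c / 2 := by
    have : 0 ≤ (y - c) ^ 2 / (2 * c) := by positivity
    have e2 : (y - c) ^ 2 / (2 * c) = (1 / (2 * c)) * y ^ 2 + c / 2 - y := by
      field_simp; ring
    linarith
  have h2 : 0 ≤ y ^ k * Real.exp (-(1 / 2) * y ^ 2) := by positivity
  calc y ^ (k + 1) * Real.exp (-(1 / 2) * y ^ 2)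
      = y * (y ^ k * Real.exp (-(1 / 2) * y ^ 2)) := by ring
    _ ≤ ((1 / (2 * c)) * y ^ 2 + c / 2) * (y ^ k * Real.exp (-(1 / 2) * y ^ 2)) := by gcongr
    _ = _ := by ring

end RadialIntegral

section StdGaussian

variable {E : Type*} [NormedAddCommGroup E] [InnerProductSpace ℝ E] [FiniteDimensional ℝ E]
  [MeasurableSpace E] [BorelSpace E]

lemma stdGaussian_eq_withDensity :
    stdGaussian E = volume.withDensity fun x : E => ENNReal.ofReal
      (((Real.pi / (1 / 2)) ^ (Module.finrank ℝ E / 2 : ℝ))⁻¹ * Real.exp (-(1 / 2) * ‖x‖ ^ 2)) := by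
  set C : ℝ := (Real.pi / (1 / 2)) ^ (Module.finrank ℝ E / 2 : ℝ) with hC
  have hCpos : 0 < C := by positivity
  set f : E → ℝ := fun x => C⁻¹ * Real.exp (-(1 / 2) * ‖x‖ ^ 2) with hf
  have hf0 : ∀ x, 0 ≤ f x := fun x => by positivity
  have hb : 0 < ((1 / 2 : ℂ)).re := by norm_num
  have hint : Integrable f := by
    have h := (GaussianFourier.integrable_cexp_neg_mul_sq_norm_add hb 0 (0 : E)).norm.const_mul C⁻¹
    refine h.congr (Filter.Eventually.of_forall fun x => ?_)
    simp only [hf, Complex.norm_exp]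
    norm_num [← Complex.ofReal_pow]
  have hmeas : Measurable f := by fun_prop
  have : IsFiniteMeasure (volume.withDensity fun x : E => ENNReal.ofReal (f x)) :=
    isFiniteMeasure_withDensity_ofReal hint.2
  refine Measure.ext_of_charFun ?_
  ext t
  rw [charFun_stdGaussian, charFun_apply,
    integral_withDensity_eq_integral_toReal_smul (by fun_prop)
      (Filter.Eventually.of_forall fun _ => ENNReal.ofReal_lt_top)]
  have h := GaussianFourier.integral_cexp_neg_mul_sq_norm_add hb Complex.I t
  have e : ∀ x : E, (ENNReal.ofReal (f x)).toReal • Complex.exp (inner ℝ x t * Complex.I)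
      = (C : ℂ)⁻¹ * Complex.exp (-(1 / 2) * ‖x‖ ^ 2 + Complex.I * inner ℝ t x) := by
    intro x
    rw [ENNReal.toReal_ofReal (hf0 x), real_inner_comm, Complex.exp_add, hf, Complex.real_smul]
    push_cast
    rw [mul_assoc, mul_comm Complex.I]
  rw [integral_congr_ae (Filter.Eventually.of_forall e), integral_const_mul, h]
  have hC2 : ((Real.pi : ℂ) / (1 / 2)) ^ (Module.finrank ℝ E / 2 : ℂ) = (C : ℂ) := by
    rw [hC, Complex.ofReal_cpow (by positivity)]
    push_cast
    rfl
  rw [hC2, inv_mul_cancel_left₀ (by exact_mod_cast hCpos.ne')]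
  congr 1
  rw [Complex.I_sq]
  ring

/-- The tail of the norm of a standard Gaussian vector, in polar coordinates. -/
lemma stdGaussian_norm_tail [Nontrivial E] (r : ℝ) (hr : 0 ≤ r) :
    (stdGaussian E).real {x | r ≤ ‖x‖} * radialTail (Module.finrank ℝ E - 1) 0
      = radialTail (Module.finrank ℝ E - 1) r := by
  set C : ℝ := (Real.pi / (1 / 2)) ^ (Module.finrank ℝ E / 2 : ℝ) with hC
  set N := Module.finrank ℝ E with hN
  have key : ∀ ρ : ℝ, 0 ≤ ρ → (stdGaussian E).real {x | ρ ≤ ‖x‖}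
      = C⁻¹ * (N * (volume : Measure E).real (Metric.ball 0 1)) * radialTail (N - 1) ρ := by
    intro ρ hρ
    have hS : MeasurableSet {x : E | ρ ≤ ‖x‖} := measurableSet_le measurable_const measurable_norm
    have h1 : (stdGaussian E).real {x | ρ ≤ ‖x‖}
        = ∫ x : E, (Set.Ici ρ).indicator
          (fun y => C⁻¹ * Real.exp (-(1 / 2) * y ^ 2)) ‖x‖ := by
      rw [← integral_indicator_one hS, stdGaussian_eq_withDensity,
        integral_withDensity_eq_integral_toReal_smul (by fun_prop)
          (Filter.Eventually.of_forall fun _ => ENNReal.ofReal_lt_top)]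
      refine integral_congr_ae (Filter.Eventually.of_forall fun x => ?_)
      beta_reduce
      rw [ENNReal.toReal_ofReal (by positivity)]
      by_cases hx : ρ ≤ ‖x‖
      · rw [Set.indicator_of_mem (by exact hx), Set.indicator_of_mem (by exact hx)]; simp [hC, hN]
      · rw [Set.indicator_of_notMem (by exact hx), Set.indicator_of_notMem (by exact hx)]; simp
    rw [h1, integral_fun_norm_addHaar]
    have h2 : ∫ y in Set.Ioi (0 : ℝ), y ^ (Module.finrank ℝ E - 1) •
          (Set.Ici ρ).indicator (fun y => C⁻¹ * Real.exp (-(1 / 2) * y ^ 2)) y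
        = C⁻¹ * radialTail (N - 1) ρ := by
      rw [radialTail, ← integral_const_mul, ← integral_Ici_eq_integral_Ioi,
        ← integral_Ici_eq_integral_Ioi, ← integral_indicator measurableSet_Ici,
        ← integral_indicator measurableSet_Ici]
      refine integral_congr_ae (Filter.Eventually.of_forall fun y => ?_)
      by_cases hy : ρ ≤ y
      · simp [Set.indicator, hy, hρ.trans hy, ← hN]; ring
      · simp [Set.indicator, hy]
    rw [h2, nsmul_eq_mul, smul_eq_mul]
    ring
  have h0 : (stdGaussian E).real {x | 0 ≤ ‖x‖} = 1 := by simp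
  have k0 := key 0 le_rfl
  rw [h0] at k0
  rw [key r hr]
  linear_combination (-radialTail (N - 1) r) * k0

end StdGaussian

/-! ### Explicit chi-squared tails and Gaussian domination -/

section ChiSquared

variable {E : Type*} [NormedAddCommGroup E] [InnerProductSpace ℝ E] [FiniteDimensional ℝ E]
  [MeasurableSpace E] [BorelSpace E]

lemma stdGaussian_norm_tail_even {k : ℕ} (hE : Module.finrank ℝ E = 2 * k + 2) {r : ℝ}
    (hr : 0 ≤ r) :
    (stdGaussian E).real {x | r ≤ ‖x‖}
      = Real.exp (-(r ^ 2 / 2)) * ∑ j ∈ Finset.range (k + 1), (r ^ 2 / 2) ^ j / j.factorial := by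
  have : Nontrivial E := Module.nontrivial_of_finrank_pos (R := ℝ) (by omega)
  have h := stdGaussian_norm_tail (E := E) r hr
  have e : Module.finrank ℝ E - 1 = 2 * k + 1 := by omega
  rw [e, radialTail_odd, radialTail_odd] at h
  have h0 : ∑ j ∈ Finset.range (k + 1), ((0 : ℝ) ^ 2 / 2) ^ j / j.factorial = 1 := by
    rw [Finset.sum_range_succ']; simp
  rw [h0, mul_left_comm] at h
  have hpos : (2 : ℝ) ^ k * k.factorial ≠ 0 := by positivity
  refine mul_left_cancel₀ hpos ?_
  simpa using h

lemma stdGaussian_norm_tail_one (hE : Module.finrank ℝ E = 1) {r : ℝ} (hr : 0 ≤ r) :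
    (stdGaussian E).real {x | r ≤ ‖x‖} ≤ Real.exp (-(r ^ 2 / 2)) := by
  have : Nontrivial E := Module.nontrivial_of_finrank_pos (R := ℝ) (by omega)
  have h := stdGaussian_norm_tail (E := E) r hr
  have e : Module.finrank ℝ E - 1 = 0 := by omega
  rw [e] at h
  have h2 := radialTail_zero_le hr
  have h3 : 0 < radialTail 0 0 := by rw [radialTail_zero_zero]; positivity
  rw [← h, mul_comm] at h2
  exact le_of_mul_le_mul_left h2 h3

/-- In dimension nine the tail is at most `1.034` times the average of the explicit tails in
dimensions eight and ten. -/
lemma stdGaussian_norm_tail_nine (hE : Module.finrank ℝ E = 9) {r : ℝ} (hr : 0 ≤ r) :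
    (stdGaussian E).real {x | r ≤ ‖x‖}
      ≤ 0.517 * Real.exp (-(r ^ 2 / 2)) *
        (2 * ∑ j ∈ Finset.range 4, (r ^ 2 / 2) ^ j / j.factorial + (r ^ 2 / 2) ^ 4 / 24) := by
  have : Nontrivial E := Module.nontrivial_of_finrank_pos (R := ℝ) (by omega)
  have h := stdGaussian_norm_tail (E := E) r hr
  have e : Module.finrank ℝ E - 1 = 8 := by omega
  rw [e, radialTail_eight_zero] at h
  -- `17 / 6` approximates `√8`, where `y ^ 8 * exp (-y² / 2)` is largest.
  have h2 := radialTail_succ_le (k := 7) (c := 17 / 6) hr (by norm_num)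
  rw [radialTail_odd 3, show 7 + 2 = 2 * 4 + 1 by norm_num, radialTail_odd 4] at h2
  change radialTail 8 r ≤ _ at h2
  rw [← h, Finset.sum_range_succ _ 4] at h2
  set X := Real.exp (-(r ^ 2 / 2)) with hX
  set S := ∑ j ∈ Finset.range 4, (r ^ 2 / 2) ^ j / (j.factorial : ℝ) with hS
  have hS0 : 0 ≤ S := Finset.sum_nonneg fun j _ => by positivity
  have hX0 : 0 < X := Real.exp_pos _
  have hsqrt : (1.2533 : ℝ) ≤ √(Real.pi / 2) := by
    refine Real.le_sqrt_of_sq_le ?_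
    have := Real.pi_gt_d6
    norm_num at this ⊢
    linarith
  set T := (stdGaussian E).real {x | r ≤ ‖x‖} with hT
  have hT0 : 0 ≤ T := measureReal_nonneg
  have h3 : T * (105 * 1.2533) ≤ T * (105 * √(Real.pi / 2)) := by gcongr
  simp only [Nat.factorial] at h2
  push_cast at h2
  have hw : 0 ≤ X * (r ^ 2 / 2) ^ 4 := by positivity
  have hXS : 0 ≤ X * S := by positivity
  norm_num1 at h2 h3 ⊢
  nlinarith

end ChiSquared

section Domination

lemma map_mulVec_gaussPi {κ ι : Type*} [Fintype κ] [Fintype ι] [DecidableEq κ] [DecidableEq ι]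
    (M : Matrix ι κ ℝ) :
    (gaussPi κ).map (fun x => WithLp.toLp 2 (M *ᵥ x)) = multivariateGaussian 0 (M * Mᵀ) := by
  have hM : Measurable fun x : κ → ℝ => WithLp.toLp 2 (M *ᵥ x) := by
    refine (WithLp.measurable_toLp 2 _).comp ?_
    exact (Continuous.matrix_mulVec continuous_const continuous_id).measurable
  refine Measure.ext_of_charFun (E := EuclideanSpace ℝ ι) ?_
  ext u
  rw [charFun_multivariateGaussian (posSemidef_mul_transpose M), charFun_apply,
    integral_map hM.aemeasurable (by fun_prop)]
  have h := charFun_stdGaussian (WithLp.toLp 2 (Mᵀ *ᵥ u.ofLp) : EuclideanSpace ℝ κ)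
  rw [← map_pi_eq_stdGaussian, charFun_apply,
    integral_map (WithLp.measurable_toLp 2 _).aemeasurable (by fun_prop)] at h
  have e : ∀ x : κ → ℝ, inner ℝ (WithLp.toLp 2 (M *ᵥ x)) u
      = inner ℝ (WithLp.toLp 2 x) (WithLp.toLp 2 (Mᵀ *ᵥ u.ofLp)) := by
    intro x
    simp only [EuclideanSpace.inner_eq_star_dotProduct, star_trivial]
    rw [Matrix.dotProduct_mulVec, Matrix.mulVec_transpose]
  simp_rw [e]
  rw [h]
  congr 1
  have e2 : ‖(WithLp.toLp 2 (Mᵀ *ᵥ u.ofLp) : EuclideanSpace ℝ κ)‖ ^ 2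
      = u.ofLp ⬝ᵥ ((M * Mᵀ) *ᵥ u.ofLp) := by
    rw [EuclideanSpace.real_norm_sq_eq, ← Matrix.mulVec_mulVec, Matrix.dotProduct_mulVec,
      ← Matrix.mulVec_transpose]
    simp [dotProduct, sq]
  rw [← e2]
  simp
  ring

open scoped MatrixOrder in
/-- A centred Gaussian vector with covariance at most `v` has lighter tails than `√v` times a
standard Gaussian vector of the same dimension. -/
lemma multivariateGaussian_tail_le {ι : Type*} [Fintype ι] [DecidableEq ι] {S : Matrix ι ι ℝ}
    (hS : S.PosSemidef) {v : ℝ} (hv : ∀ u : ι → ℝ, u ⬝ᵥ (S *ᵥ u) ≤ v * (u ⬝ᵥ u)) (t : ℝ) :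
    (multivariateGaussian 0 S).real {x | t ≤ ‖x‖}
      ≤ (stdGaussian (EuclideanSpace ℝ ι)).real {x | t ≤ √v * ‖x‖} := by
  have hm : Measurable fun x : EuclideanSpace ℝ ι =>
      (0 : EuclideanSpace ℝ ι) + Matrix.toEuclideanCLM (𝕜 := ℝ) (CFC.sqrt S) x := by fun_prop
  rw [multivariateGaussian, map_measureReal_apply hm
    (measurableSet_le measurable_const measurable_norm)]
  refine measureReal_mono fun x hx => ?_
  simp only [Set.mem_preimage, Set.mem_ofPred_eq, zero_add] at hx ⊢
  refine hx.trans ?_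
  have e : ‖Matrix.toEuclideanCLM (𝕜 := ℝ) (CFC.sqrt S) x‖ ^ 2 = x.ofLp ⬝ᵥ (S *ᵥ x.ofLp) := by
    have hsa : IsSelfAdjoint (Matrix.toEuclideanCLM (𝕜 := ℝ) (CFC.sqrt S)) :=
      (CFC.sqrt_nonneg S).isSelfAdjoint.map _
    rw [← real_inner_self_eq_norm_sq, ← ContinuousLinearMap.adjoint_inner_right,
      IsSelfAdjoint.adjoint_eq hsa, ← ContinuousLinearMap.comp_apply,
      ← ContinuousLinearMap.mul_def, ← map_mul,
      CFC.sqrt_mul_sqrt_self _ hS.nonneg, Matrix.inner_toEuclideanCLM]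
  have e2 : x.ofLp ⬝ᵥ x.ofLp = ‖x‖ ^ 2 := by
    rw [EuclideanSpace.real_norm_sq_eq]; simp [dotProduct, sq]
  have h := hv x.ofLp
  rw [← e, e2] at h
  rw [← Real.sqrt_sq (norm_nonneg x), ← Real.sqrt_mul' _ (sq_nonneg _)]
  exact Real.le_sqrt_of_sq_le h

variable {m n r s : Type*} [Fintype m] [Fintype n] [DecidableEq m] [DecidableEq n]
  [Fintype r] [Fintype s] [DecidableEq r] [DecidableEq s] (A : Matrix r m ℝ) (B : Matrix n s ℝ)

omit [DecidableEq m] [DecidableEq n] [Fintype r] [Fintype s] [DecidableEq r] [DecidableEq s] in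
open scoped Kronecker in
/-- The entries of `A X B` are the coordinates of `A ⊗ Bᵀ` applied to the vectorization of `X`. -/
lemma gaussMatrix_apply_eq_kronecker (x : m × n → ℝ) (ij : r × s) :
    gaussMatrix A B x ij.1 ij.2 = ((A ⊗ₖ Bᵀ) *ᵥ x) ij := by
  simp only [gaussMatrix, Matrix.mul_apply, Matrix.mulVec, dotProduct, Fintype.sum_prod_type,
    Matrix.kroneckerMap_apply, Matrix.transpose_apply, Matrix.of_apply, Finset.sum_mul]
  rw [Finset.sum_comm]
  exact Finset.sum_congr rfl fun l _ => Finset.sum_congr rfl fun i _ => by ring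

lemma trace_mul_transpose_eq_sum {a b : Type*} [Fintype a] [Fintype b] (M : Matrix a b ℝ) :
    (M * Mᵀ).trace = ∑ ij : a × b, M ij.1 ij.2 ^ 2 := by
  simp [Matrix.trace, Matrix.mul_apply, Fintype.sum_prod_type, sq]

open scoped Kronecker in
/-- Bounding the spectral norm by the Frobenius norm, whose covariance `A Aᵀ ⊗ Bᵀ B` is at most
`v`. -/
lemma gaussTail_le_stdGaussian {v : ℝ} (hv : v = ‖A * Aᵀ‖ * ‖Bᵀ * B‖) (t : ℝ) :
    gaussTail A B t
      ≤ (stdGaussian (EuclideanSpace ℝ (r × s))).real {x | t ≤ √v * ‖x‖} := by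
  have hm : Measurable fun x : m × n → ℝ => WithLp.toLp 2 ((A ⊗ₖ Bᵀ) *ᵥ x) := by
    refine (WithLp.measurable_toLp 2 _).comp ?_
    exact (Continuous.matrix_mulVec continuous_const continuous_id).measurable
  refine le_trans ?_ (multivariateGaussian_tail_le (posSemidef_mul_transpose (A ⊗ₖ Bᵀ))
    (v := v) (fun u => ?_) t)
  · rw [← map_mulVec_gaussPi, map_measureReal_apply hm
      (measurableSet_le measurable_const measurable_norm)]
    refine measureReal_mono fun x hx => ?_
    simp only [Set.mem_preimage, Set.mem_ofPred_eq] at hx ⊢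
    refine hx.trans ?_
    have h := norm_pow_le_trace_pow (gaussMatrix A B x) one_ne_zero
    rw [pow_one, pow_one, trace_mul_transpose_eq_sum] at h
    simp_rw [gaussMatrix_apply_eq_kronecker] at h
    refine le_of_sq_le_sq ?_ (norm_nonneg _)
    rw [EuclideanSpace.real_norm_sq_eq]
    exact h
  · set G : Matrix r s ℝ := Matrix.of fun i j => u (i, j) with hG
    have e1 : u ⬝ᵥ (((A ⊗ₖ Bᵀ) * (A ⊗ₖ Bᵀ)ᵀ) *ᵥ u)
        = ((Aᵀ * G * Bᵀ) * (Aᵀ * G * Bᵀ)ᵀ).trace := by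
      rw [trace_mul_transpose_eq_sum, ← Matrix.mulVec_mulVec, Matrix.dotProduct_mulVec,
        ← Matrix.mulVec_transpose]
      have : ∀ ij : m × n, (Aᵀ * G * Bᵀ) ij.1 ij.2 = ((A ⊗ₖ Bᵀ)ᵀ *ᵥ u) ij := by
        intro ij
        have := gaussMatrix_apply_eq_kronecker Aᵀ Bᵀ u ij
        rw [gaussMatrix, Matrix.transpose_transpose] at this
        rw [hG, this, ← Matrix.kroneckerMap_transpose, Matrix.transpose_transpose]
      simp_rw [this, dotProduct, sq]
    have e2 : u ⬝ᵥ u = ((G * Gᵀ) ^ 1).trace := by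
      rw [pow_one, trace_mul_transpose_eq_sum]
      simp [hG, dotProduct, sq]
    have h1 := (trace_left_mul_pow_le (G * Bᵀ) (posSemidef_mul_transpose A) one_ne_zero).2
    have h2 := (trace_right_mul_pow_le G (posSemidef_transpose_mul B) one_ne_zero).2
    have e3 : ((Aᵀ * G * Bᵀ) * (Aᵀ * G * Bᵀ)ᵀ).trace
        = (A * Aᵀ * (G * Bᵀ * (G * Bᵀ)ᵀ) ^ 1).trace := by
      rw [pow_one, Matrix.trace_mul_comm, Matrix.mul_assoc A, Matrix.trace_mul_comm A,
        Matrix.trace_mul_comm]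
      simp only [Matrix.transpose_mul, Matrix.transpose_transpose, Matrix.mul_assoc]
    have e4 : ((G * Bᵀ * (G * Bᵀ)ᵀ) ^ 1).trace = (Bᵀ * B * (Gᵀ * G) ^ 1).trace := by
      rw [pow_one, pow_one, Matrix.transpose_mul, Matrix.transpose_transpose, Matrix.mul_assoc,
        Matrix.trace_mul_comm]
      simp only [Matrix.mul_assoc]
    rw [e1, e2, e3, hv]
    rw [e4] at h1
    calc _ ≤ _ := h1
      _ ≤ ‖A * Aᵀ‖ * (‖Bᵀ * B‖ * ((G * Gᵀ) ^ 1).trace) := by gcongr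
      _ = _ := by ring

end Domination

/-! ### Numerical estimates -/

section Numerics

lemma exp_div_le_of_pow_le {a b : ℕ} {C : ℝ} (hb : b ≠ 0) (hC : 0 ≤ C)
    (h : (2.7182818286 : ℝ) ^ a ≤ C ^ b) : Real.exp (a / b) ≤ C := by
  refine le_of_pow_le_pow_left₀ hb hC ?_
  rw [← Real.exp_nat_mul, mul_div_cancel₀ _ (by exact_mod_cast hb), ← mul_one (a : ℝ),
    Real.exp_nat_mul]
  exact (pow_le_pow_left₀ (Real.exp_pos _).le Real.exp_one_lt_d9.le _).trans h

lemma le_exp_div_of_le_pow {a b : ℕ} {C : ℝ} (hb : b ≠ 0)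
    (h : C ^ b ≤ (2.7182818283 : ℝ) ^ a) : C ≤ Real.exp (a / b) := by
  refine le_of_pow_le_pow_left₀ hb (Real.exp_pos _).le ?_
  rw [← Real.exp_nat_mul, mul_div_cancel₀ _ (by exact_mod_cast hb), ← mul_one (a : ℝ),
    Real.exp_nat_mul]
  exact h.trans (pow_le_pow_left₀ (by norm_num) Real.exp_one_gt_d9.le _)

/-- Since `p log x - x / 2` is concave in `x`, lower bounds for `x ^ p * exp (-x / 2)` on an
interval may be checked at the endpoints. -/
lemma mul_exp_le_pow_of_endpoints {p : ℕ} {u w x c : ℝ} (hu0 : 0 < u) (hc : 0 < c)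
    (hux : u ≤ x) (hxw : x ≤ w) (hu : c * Real.exp (u / 2) ≤ u ^ p)
    (hw : c * Real.exp (w / 2) ≤ w ^ p) : c * Real.exp (x / 2) ≤ x ^ p := by
  have key : ∀ y : ℝ, 0 < y → (c * Real.exp (y / 2) ≤ y ^ p ↔
      Real.log c + y / 2 - p * Real.log y ≤ 0) := by
    intro y hy
    rw [← Real.log_le_log_iff (by positivity) (by positivity), Real.log_mul hc.ne'
      (Real.exp_pos _).ne', Real.log_exp, Real.log_pow]
    constructor <;> intro h <;> linarith
  have hconv : ConvexOn ℝ (Set.Ioi 0)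
      fun y : ℝ => Real.log c + y / 2 - p * Real.log y := by
    refine ConvexOn.sub ?_ ?_
    · refine (convexOn_const _ (convex_Ioi 0)).add ?_
      simpa [div_eq_inv_mul] using (convexOn_id (convex_Ioi (0 : ℝ))).smul
        (by norm_num : (0 : ℝ) ≤ 2⁻¹)
    · simpa using strictConcaveOn_log_Ioi.concaveOn.smul (Nat.cast_nonneg p)
  rw [key _ (hu0.trans_le hux)]
  refine (hconv.le_max_of_mem_Icc hu0 (hu0.trans_le (hux.trans hxw)) ⟨hux, hxw⟩).trans ?_
  exact max_le ((key _ hu0).1 hu) ((key _ (hu0.trans_le (hux.trans hxw))).1 hw)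

/-- The upper bound `e ≤ (1 + 2 / (2 p + 1)) ^ (p + 1)`, without denominators. -/
lemma exp_one_le_pow (p : ℕ) :
    Real.exp 1 * (2 * p + 1 : ℝ) ^ (p + 1) ≤ (2 * p + 3) ^ (p + 1) := by
  have hp : (0 : ℝ) < 2 * p + 1 := by positivity
  have h := Real.le_log_one_add_of_nonneg (x := 2 / (2 * p + 1)) (by positivity)
  have e : 2 * (2 / (2 * p + 1 : ℝ)) / (2 / (2 * p + 1) + 2) = 1 / (p + 1) := by
    field_simp
    ring
  have e2 : 1 + 2 / (2 * p + 1 : ℝ) = (2 * p + 3) / (2 * p + 1) := by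
    field_simp
    ring
  rw [e, e2, Real.le_log_iff_exp_le (by positivity)] at h
  have h2 := pow_le_pow_left₀ (by positivity) h (p + 1)
  rw [← Real.exp_nat_mul] at h2
  have e3 : ((p + 1 : ℕ) : ℝ) * (1 / (p + 1)) = 1 := by
    push_cast
    field_simp
  rw [e3, div_pow, le_div_iff₀ (by positivity)] at h2
  exact h2

lemma exp_half_le_of_pow_le (a b : ℕ) {u C : ℝ} (hb : b ≠ 0) (hC : 0 ≤ C) (hu : u / 2 = a / b)
    (h : (2.7182818286 : ℝ) ^ a ≤ C ^ b) : Real.exp (u / 2) ≤ C := by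
  rw [hu]
  exact exp_div_le_of_pow_le hb hC h

lemma mul_exp_half_le_of_pow_le (a b p : ℕ) {u c : ℝ} (hb : b ≠ 0) (hc : 0 < c) (hu0 : 0 ≤ u)
    (hu : u / 2 = a / b) (h : (2.7182818286 : ℝ) ^ a ≤ (u ^ p / c) ^ b) :
    c * Real.exp (u / 2) ≤ u ^ p := by
  rw [hu, ← le_div_iff₀' hc]
  exact exp_div_le_of_pow_le hb (by positivity) h

/-- The ratio of the two sides decreases in `p`, so the constant, slightly above
`3 * exp (5 / 2) / 25`, comes from `p = 2`. -/
lemma oddFactorial_mul_exp_le_endpoint {p : ℕ} (hp : 2 ≤ p) :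
    oddFactorial p * Real.exp ((2 * p + 1) / 2) ≤ 1.462 * (2 * p + 1 : ℝ) ^ p := by
  induction p, hp using Nat.le_induction with
  | base =>
    have h := exp_div_le_of_pow_le (a := 5) (b := 2) (C := 12.1833) (by norm_num) (by norm_num)
      (by norm_num)
    simp only [oddFactorial, Finset.prod_range_succ, Finset.prod_range_zero]
    norm_num at h ⊢
    linarith
  | succ p hp ih =>
    have e : (2 * ((p + 1 : ℕ) : ℝ) + 1) / 2 = 1 + (2 * p + 1) / 2 := by push_cast; ring
    rw [e, Real.exp_add, oddFactorial_succ]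
    have h := exp_one_le_pow p
    have e3 : (2 * ((p + 1 : ℕ) : ℝ) + 1) = 2 * p + 3 := by push_cast; ring
    rw [e3]
    have h1 := mul_le_mul_of_nonneg_left ih
      (by positivity : 0 ≤ Real.exp 1 * (2 * p + 1 : ℝ))
    have h2 := mul_le_mul_of_nonneg_left h (by norm_num : (0 : ℝ) ≤ 1.462)
    rw [pow_succ (2 * p + 1 : ℝ)] at h2
    linarith

/-- The exponent `p` is chosen with `2 p - 1 ≤ x ≤ 2 p + 1`; the worst values of `x` are the
endpoints. -/
lemma oddFactorial_mul_exp_le {x : ℝ} (hx : 5 ≤ x) :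
    ∃ p : ℕ, 3 ≤ p ∧ oddFactorial p * Real.exp (x / 2) ≤ 1.462 * x ^ p := by
  obtain ⟨p, hp, hp1, hp2⟩ : ∃ p : ℕ, 2 ≤ p ∧ (2 * p + 1 : ℝ) ≤ x ∧ x ≤ 2 * p + 3 := by
    refine ⟨⌊(x - 1) / 2⌋₊, Nat.le_floor (by push_cast; linarith), ?_, ?_⟩
    · have := Nat.floor_le (a := (x - 1) / 2) (by linarith)
      linarith
    · have := Nat.lt_floor_add_one ((x - 1) / 2)
      linarith
  have h1 := oddFactorial_mul_exp_le_endpoint hp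
  have h2 := oddFactorial_mul_exp_le_endpoint (p := p + 1) (by omega)
  have e : (2 * ((p + 1 : ℕ) : ℝ) + 1) = 2 * p + 3 := by push_cast; ring
  rw [e] at h2
  refine ⟨p + 1, by omega, ?_⟩
  have h := mul_exp_le_pow_of_endpoints (p := p + 1) (c := oddFactorial (p + 1) / 1.462)
    (by positivity) (div_pos (oddFactorial_pos _) (by norm_num)) hp1 hp2 ?_ ?_
  · rw [div_mul_eq_mul_div, div_le_iff₀ (by norm_num)] at h
    linarith
  · rw [div_mul_eq_mul_div, div_le_iff₀ (by norm_num), oddFactorial_succ, pow_succ]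
    have := mul_le_mul_of_nonneg_right h1 (by positivity : (0 : ℝ) ≤ 2 * p + 1)
    linarith
  · rw [div_mul_eq_mul_div, div_le_iff₀ (by norm_num)]
    linarith

/-- Monotonicity of `S z * exp (-c * z)` read off from the logarithmic derivative of `S`. -/
lemma mul_exp_neg_le_of_deriv {S S' : ℝ → ℝ} (hS : ∀ z, HasDerivAt S (S' z) z) {c a b : ℝ}
    (hab : a ≤ b) (h : ∀ z, a < z → z < b → c * S z ≤ S' z) :
    S a * Real.exp (-(c * a)) ≤ S b * Real.exp (-(c * b)) := by
  have hd : ∀ z, HasDerivAt (fun z => S z * Real.exp (-(c * z)))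
      (S' z * Real.exp (-(c * z)) + S z * (Real.exp (-(c * z)) * -c)) z := by
    intro z
    refine (hS z).mul (HasDerivAt.exp ?_)
    simpa [Pi.neg_def] using ((hasDerivAt_id z).const_mul c).neg
  refine monotoneOn_of_deriv_nonneg (convex_Icc a b)
    (fun z _ => (hd z).continuousAt.continuousWithinAt)
    (fun z _ => (hd z).differentiableAt.differentiableWithinAt) (fun z hz => ?_)
    (Set.left_mem_Icc.2 hab) (Set.right_mem_Icc.2 hab) hab
  rw [interior_Icc] at hz
  rw [(hd z).deriv]
  have := h z hz.1 hz.2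
  have h3 := Real.exp_pos (-(c * z))
  nlinarith

/-- The truncated exponential series `∑ j < k, z ^ j / j!`. -/
noncomputable def expTrunc (k : ℕ) (z : ℝ) : ℝ := ∑ j ∈ Finset.range k, z ^ j / j.factorial

lemma hasDerivAt_expTrunc (k : ℕ) (z : ℝ) :
    HasDerivAt (expTrunc (k + 1)) (expTrunc k z) z := by
  induction k with
  | zero =>
    have e : expTrunc 1 = fun _ => 1 := by
      ext z
      simp [expTrunc]
    simpa [e, expTrunc] using hasDerivAt_const z (1 : ℝ)
  | succ k ih =>
    have e : expTrunc (k + 1 + 1)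
        = fun z => expTrunc (k + 1) z + z ^ (k + 1) / (k + 1).factorial := by
      ext z
      exact Finset.sum_range_succ _ _
    rw [e]
    refine (ih.add ((hasDerivAt_pow (k + 1) z).div_const _)).congr_deriv ?_
    rw [expTrunc, expTrunc, Finset.sum_range_succ, Nat.factorial_succ]
    congr 1
    push_cast
    field_simp

lemma exp_neg_mul_antitone {S S' : ℝ → ℝ} (hS : ∀ z, HasDerivAt S (S' z) z)
    (h : ∀ z, 0 < z → S' z ≤ S z) {y z : ℝ} (hy : 0 ≤ y) (hyz : y ≤ z) :
    Real.exp (-z) * S z ≤ Real.exp (-y) * S y := by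
  have := mul_exp_neg_le_of_deriv (S := fun z => -S z) (S' := fun z => -S' z)
    (fun z => by simpa [Pi.neg_def] using (hS z).neg) (c := 1) hyz (fun w hw _ => by
      have := h w (hy.trans_lt hw)
      linarith)
  simp only [one_mul] at this
  linarith

/-- The comparison `exp (-z) * S z ≤ q * exp (-x / 2)` for `z ≥ l₀ * x / 2` and `x ≤ w` reduces to
a single inequality at `x = w`. -/
lemma exp_neg_mul_le_of_endpoint {S S' : ℝ → ℝ} (hS : ∀ z, HasDerivAt S (S' z) z)
    {l₀ l x w q : ℝ} (hl₀ : 1 ≤ l₀) (hl : l₀ ≤ l) (hx : 0 ≤ x) (hxw : x ≤ w)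
    (h1 : ∀ z, 0 < z → S' z ≤ S z)
    (h2 : ∀ z, 0 < z → z ≤ l₀ * w / 2 → (l₀ - 1) * S z ≤ l₀ * S' z)
    (h3 : S (l₀ * w / 2) ≤ q * Real.exp ((l₀ - 1) * (w / 2))) :
    Real.exp (-(l * x / 2)) * S (l * x / 2) ≤ q * Real.exp (-(x / 2)) := by
  have hl0 : 0 < l₀ := by linarith
  have hz0 : 0 ≤ l₀ * x / 2 := by positivity
  have a1 := exp_neg_mul_antitone hS h1 hz0 (by gcongr : l₀ * x / 2 ≤ l * x / 2)
  have a2 := mul_exp_neg_le_of_deriv hS (c := (l₀ - 1) / l₀) (a := l₀ * x / 2) (b := l₀ * w / 2)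
    (by gcongr) (fun z hz hz' => by
      rw [div_mul_eq_mul_div, div_le_iff₀ hl0]
      linarith [h2 z (hz0.trans_lt hz) hz'.le])
  have e : ∀ y : ℝ, (l₀ - 1) / l₀ * (l₀ * y / 2) = (l₀ - 1) * (y / 2) := by
    intro y
    field_simp
  rw [e, e] at a2
  have a3 : S (l₀ * x / 2) * Real.exp (-((l₀ - 1) * (x / 2))) ≤ q := by
    refine a2.trans ?_
    rw [Real.exp_neg, ← div_eq_mul_inv, div_le_iff₀ (Real.exp_pos _)]
    exact h3
  have a4 := mul_le_mul_of_nonneg_right a3 (Real.exp_pos (-(x / 2))).le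
  rw [mul_assoc, ← Real.exp_add] at a4
  have e2 : -((l₀ - 1) * (x / 2)) + -(x / 2) = -(l₀ * x / 2) := by ring
  rw [e2] at a4
  linarith

/-- The numerical content of the moment bounds for a tail probability `ρ`, in the variables
`x = t² / L` and `l = L / v`. -/
structure TailMoments (ρ l x : ℝ) : Prop where
  le_one : ρ ≤ 1
  one_le : 1 ≤ l
  pos : 0 < x
  first : ρ * x ≤ l
  second : ρ * x ^ 2 ≤ 2 * l + 1
  higher : ∀ p : ℕ, 3 ≤ p → ρ * x ^ p ≤ cubicMoment l / 15 * oddFactorial p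

variable {ρ l x : ℝ}

lemma cubicMoment_mono {l u : ℝ} (hl : 1 ≤ l) (hu : l ≤ u) : cubicMoment l ≤ cubicMoment u := by
  have hl0 : 0 < l := by linarith
  have hu0 : 0 < u := by linarith
  have h : 4 / l - 4 / u ≤ 4 * (u - l) := by
    rw [div_sub_div _ _ hl0.ne' hu0.ne', div_le_iff₀ (by positivity)]
    nlinarith [mul_nonneg (sub_nonneg.2 hu) (by nlinarith : 0 ≤ l * u - 1)]
  simp only [cubicMoment]
  linarith

namespace TailMoments

/-- A Markov bound of order `p` suffices wherever `c * exp (x / 2) ≤ x ^ p` for a suitable `c`. -/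
lemma le_of_pow (h : TailMoments ρ l x) {p : ℕ} {c N q : ℝ} (hN : ρ * x ^ p ≤ N) (hq : 0 ≤ q)
    (hc : c * Real.exp (x / 2) ≤ x ^ p) (hcN : N ≤ q * c) : ρ ≤ q * Real.exp (-(x / 2)) := by
  have hx := h.pos
  rw [Real.exp_neg, ← div_eq_mul_inv, le_div_iff₀ (Real.exp_pos _)]
  refine le_of_mul_le_mul_right ?_ (pow_pos hx p)
  calc ρ * Real.exp (x / 2) * x ^ p = ρ * x ^ p * Real.exp (x / 2) := by ring
    _ ≤ q * c * Real.exp (x / 2) :=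
      mul_le_mul_of_nonneg_right (hN.trans hcN) (Real.exp_pos _).le
    _ = q * (c * Real.exp (x / 2)) := by ring
    _ ≤ q * x ^ p := by gcongr

/-- For `x ≤ 2 log q` the claimed bound is at least `1`. -/
lemma le_of_small (h : TailMoments ρ l x) {q u : ℝ} (hu : Real.exp (u / 2) ≤ q) (hx : x ≤ u) :
    ρ ≤ q * Real.exp (-(x / 2)) := by
  rw [Real.exp_neg, ← div_eq_mul_inv, le_div_iff₀ (Real.exp_pos _)]
  calc ρ * Real.exp (x / 2) ≤ 1 * Real.exp (u / 2) := by
        gcongr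
        exact h.le_one
    _ ≤ q := by rwa [one_mul]

lemma third (h : TailMoments ρ l x) : ρ * x ^ 3 ≤ cubicMoment l := by
  refine (h.higher 3 le_rfl).trans (le_of_eq ?_)
  simp only [oddFactorial, Finset.prod_range_succ, Finset.prod_range_zero]
  norm_num

/-- Large deviations: the order of the moment grows with `x`. -/
lemma le_of_five_le (h : TailMoments ρ l x) {q : ℝ} (hq : 2 ≤ q) (hl : l ≤ q) (hx : 5 ≤ x) :
    ρ ≤ q * Real.exp (-(x / 2)) := by
  obtain ⟨p, hp, hpx⟩ := oddFactorial_mul_exp_le hx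
  have h1 := h.higher p hp
  have h0 := oddFactorial_pos p
  refine h.le_of_pow h1 (by linarith) (c := oddFactorial p / 1.462) ?_ ?_
  · rw [div_mul_eq_mul_div, div_le_iff₀ (by norm_num)]
    linarith
  · have h2 := cubicMoment_mono h.one_le hl
    have h3 : 4 / q ≤ 2 := by rw [div_le_iff₀ (by linarith)]; linarith
    have h4 : cubicMoment l / 15 ≤ q / 1.462 := by
      simp only [cubicMoment] at h2 ⊢
      rw [div_le_div_iff₀ (by norm_num) (by norm_num)]
      linarith
    calc _ ≤ q / 1.462 * oddFactorial p := by gcongr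
      _ = _ := by ring

/-- In dimension at least five the third moment covers everything between the trivial range and
`5 ≤ x`: `6.36` is the value of `cubicMoment q / q` at `q = 5`, and `x ^ 3 * exp (-x / 2)` exceeds
it on `[3.2, 5]`. -/
lemma le_of_five_le_dim (h : TailMoments ρ l x) {q : ℝ} (hq : 5 ≤ q) (hl : l ≤ q) :
    ρ ≤ q * Real.exp (-(x / 2)) := by
  have e1 := exp_div_le_of_pow_le (a := 8) (b := 5) (C := 4.96) (by norm_num) (by norm_num)
    (by norm_num)
  have e2 := exp_div_le_of_pow_le (a := 5) (b := 2) (C := 12.2) (by norm_num) (by norm_num)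
    (by norm_num)
  norm_num1 at e1 e2
  rcases le_total x 3.2 with hx | hx
  · refine h.le_of_small (u := 3.2) ?_ hx
    norm_num1
    linarith
  rcases le_total 5 x with hx5 | hx5
  · exact h.le_of_five_le (by linarith) hl hx5
  refine h.le_of_pow h.third (by linarith) (c := 6.36)
    (mul_exp_le_pow_of_endpoints (by norm_num) (by norm_num) hx hx5 ?_ ?_) ?_
  · norm_num1
    linarith
  · norm_num1
    linarith
  · have h2 := cubicMoment_mono h.one_le hl
    have h3 : 4 / q ≤ 4 / 5 := by gcongr
    simp only [cubicMoment] at h2 ⊢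
    linarith

lemma le_dim_one (h : TailMoments ρ l x) (hc : ρ ≤ Real.exp (-(l * x / 2))) :
    ρ ≤ 1 * Real.exp (-(x / 2)) := by
  rw [one_mul]
  refine hc.trans (Real.exp_le_exp.2 ?_)
  nlinarith [h.one_le, h.pos]

/-- In dimension two the chi-squared comparison settles `4 / 3 ≤ l`, and for smaller `l` the first
two moments suffice. -/
lemma le_dim_two (h : TailMoments ρ l x) (hl : l ≤ 2)
    (hc : ρ ≤ Real.exp (-(l * x / 2)) * expTrunc 2 (l * x / 2)) :
    ρ ≤ 2 * Real.exp (-(x / 2)) := by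
  have hx := h.pos
  rcases le_total (4 / 3) l with hl0 | hl0
  · have e1 : ∀ z, expTrunc 2 z = 1 + z := fun z => by simp [expTrunc, Finset.sum_range_succ]
    refine hc.trans ((exp_neg_mul_antitone (hasDerivAt_expTrunc 1) (fun z hz => ?_)
      (by positivity) (by gcongr : 4 / 3 * x / 2 ≤ l * x / 2)).trans ?_)
    · rw [e1]
      simp [expTrunc, hz.le]
    · have e2 : -(x / 2) = -(4 / 3 * x / 2) + x / 6 := by ring
      rw [e1, e2, Real.exp_add, mul_left_comm]
      refine mul_le_mul_of_nonneg_left ?_ (Real.exp_pos _).le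
      nlinarith [Real.quadratic_le_exp_of_nonneg (by positivity : 0 ≤ x / 6),
        sq_nonneg (1 - x / 6)]
  rcases le_total 5 x with h5 | h5
  · exact h.le_of_five_le le_rfl hl h5
  rcases le_total x 1.3 with h1 | h1
  · exact h.le_of_small (exp_half_le_of_pow_le 13 20 (by norm_num) (by norm_num) (by norm_num)
      (by norm_num)) h1
  rcases le_total x 2.8 with h2 | h2
  · refine h.le_of_pow (p := 1) (c := 0.67) (by simpa using h.first) (by norm_num)
      (mul_exp_le_pow_of_endpoints (by norm_num) (by norm_num) h1 h2 ?_ ?_) (by linarith)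
    · exact mul_exp_half_le_of_pow_le 13 20 1 (by norm_num) (by norm_num) (by norm_num)
        (by norm_num) (by norm_num)
    · exact mul_exp_half_le_of_pow_le 7 5 1 (by norm_num) (by norm_num) (by norm_num)
        (by norm_num) (by norm_num)
  · refine h.le_of_pow (p := 2) (c := 1.9) h.second (by norm_num)
      (mul_exp_le_pow_of_endpoints (by norm_num) (by norm_num) h2 h5 ?_ ?_) (by linarith)
    · exact mul_exp_half_le_of_pow_le 7 5 2 (by norm_num) (by norm_num) (by norm_num)
        (by norm_num) (by norm_num)
    · exact mul_exp_half_le_of_pow_le 5 2 2 (by norm_num) (by norm_num) (by norm_num)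
        (by norm_num) (by norm_num)

/-- In dimension three the chi-squared comparison is used only for `2.15 ≤ l`. There it improves
as `l` grows while the moment bounds deteriorate, so `[2.15, 3]` is cut into intervals; on each, the
comparison at the left end handles small `x` and a moment bound at the right end handles large
`x`. The same pattern recurs in dimension four. -/
lemma le_dim_three (h : TailMoments ρ l x) (hl : l ≤ 3)
    (hc : ρ ≤ Real.exp (-(l * x / 2)) *
      (0.517 * (expTrunc 5 (l * x / 2) + expTrunc 4 (l * x / 2)))) :
    ρ ≤ 3 * Real.exp (-(x / 2)) := by
  have hx := h.pos
  have hd : ∀ z, HasDerivAt (fun z => 0.517 * (expTrunc 5 z + expTrunc 4 z))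
      (0.517 * (expTrunc 4 z + expTrunc 3 z)) z := fun z =>
    ((hasDerivAt_expTrunc 4 z).add (hasDerivAt_expTrunc 3 z)).const_mul _
  have chi : ∀ l₀ w : ℝ, 1 ≤ l₀ → l₀ ≤ l → x ≤ w → l₀ * w / 2 ≤ 4.375 → l₀ ≤ 2.5 →
      0.517 * (expTrunc 5 (l₀ * w / 2) + expTrunc 4 (l₀ * w / 2))
        ≤ 3 * Real.exp ((l₀ - 1) * (w / 2)) → ρ ≤ 3 * Real.exp (-(x / 2)) := by
    intro l₀ w h1 h2 h3 h4 h5 h6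
    refine hc.trans (exp_neg_mul_le_of_endpoint hd h1 h2 hx.le h3 (fun z hz => ?_)
      (fun z hz hz2 => ?_) h6)
    · simp only [expTrunc, Finset.sum_range_succ, Finset.sum_range_zero, Nat.factorial]
      push_cast
      have a3 : 0 < z ^ 3 := by positivity
      have a4 : 0 < z ^ 4 := by positivity
      linarith
    · have hz3 : z ≤ 4.375 := hz2.trans h4
      have b : ∀ k : ℕ, z ^ (k + 1) ≤ 4.375 * z ^ k := fun k => by
        rw [pow_succ']
        gcongr
      suffices hs : 2.5 * (z ^ 3 / 6 + z ^ 4 / 24) ≤ expTrunc 5 z + expTrunc 4 z by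
        have e : expTrunc 5 z + expTrunc 4 z
            = expTrunc 4 z + expTrunc 3 z + (z ^ 3 / 6 + z ^ 4 / 24) := by
          simp only [expTrunc, Finset.sum_range_succ, Finset.sum_range_zero, Nat.factorial]
          push_cast
          ring
        have h7 : l₀ * (z ^ 3 / 6 + z ^ 4 / 24) ≤ 2.5 * (z ^ 3 / 6 + z ^ 4 / 24) := by gcongr
        rw [e] at hs ⊢
        linarith
      simp only [expTrunc, Finset.sum_range_succ, Finset.sum_range_zero, Nat.factorial]
      have b0 := b 0
      have b1 := b 1
      have b2 := b 2
      have b3 := b 3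
      push_cast
      norm_num at b0 b1 b2 b3 ⊢
      linarith
  rcases le_total 5 x with h5 | h5
  · exact h.le_of_five_le (by norm_num) hl h5
  rcases le_total x 2 with h1 | h1
  · exact h.le_of_small (exp_half_le_of_pow_le 1 1 (by norm_num) (by norm_num) (by norm_num)
      (by norm_num)) h1
  rcases le_total l 2.15 with hl1 | hl1
  · rcases le_total x 2.46 with h2 | h2
    · refine h.le_of_pow (p := 1) (c := 0.717) (by simpa using h.first) (by norm_num)
        (mul_exp_le_pow_of_endpoints (by norm_num) (by norm_num) h1 h2 ?_ ?_) (by linarith)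
      · exact mul_exp_half_le_of_pow_le 1 1 1 (by norm_num) (by norm_num) (by norm_num)
          (by norm_num) (by norm_num)
      · exact mul_exp_half_le_of_pow_le 123 100 1 (by norm_num) (by norm_num) (by norm_num)
          (by norm_num) (by norm_num)
    · refine h.le_of_pow (p := 2) (c := 1.767) h.second (by norm_num)
        (mul_exp_le_pow_of_endpoints (by norm_num) (by norm_num) h2 h5 ?_ ?_) (by linarith)
      · exact mul_exp_half_le_of_pow_le 123 100 2 (by norm_num) (by norm_num) (by norm_num)
          (by norm_num) (by norm_num)
      · exact mul_exp_half_le_of_pow_le 5 2 2 (by norm_num) (by norm_num) (by norm_num)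
          (by norm_num) (by norm_num)
  rcases le_total l 2.3 with hl2 | hl2
  · rcases le_total x 2.66 with h2 | h2
    · refine chi 2.15 2.66 (by norm_num) hl1 h2 (by norm_num) (by norm_num) ?_
      have e := le_exp_div_of_le_pow (a := 38) (b := 25) (C := 4.565) (by norm_num) (by norm_num)
      have e2 : Real.exp ((38 : ℕ) / (25 : ℕ)) ≤ Real.exp ((2.15 - 1) * (2.66 / 2)) :=
        Real.exp_le_exp.2 (by norm_num)
      refine le_trans ?_ (mul_le_mul_of_nonneg_left (e.trans e2) (by norm_num))
      norm_num [expTrunc, Finset.sum_range_succ, Nat.factorial]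
    · refine h.le_of_pow (p := 2) (c := 1.867) h.second (by norm_num)
        (mul_exp_le_pow_of_endpoints (by norm_num) (by norm_num) h2 h5 ?_ ?_) (by linarith)
      · exact mul_exp_half_le_of_pow_le 133 100 2 (by norm_num) (by norm_num) (by norm_num)
          (by norm_num) (by norm_num)
      · exact mul_exp_half_le_of_pow_le 5 2 2 (by norm_num) (by norm_num) (by norm_num)
          (by norm_num) (by norm_num)
  rcases le_total l 2.5 with hl3 | hl3
  · rcases le_total x 2.98 with h2 | h2
    · refine chi 2.3 2.98 (by norm_num) hl2 h2 (by norm_num) (by norm_num) ?_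
      have e := le_exp_div_of_le_pow (a := 193) (b := 100) (C := 6.87) (by norm_num) (by norm_num)
      have e2 : Real.exp ((193 : ℕ) / (100 : ℕ)) ≤ Real.exp ((2.3 - 1) * (2.98 / 2)) :=
        Real.exp_le_exp.2 (by norm_num)
      refine le_trans ?_ (mul_le_mul_of_nonneg_left (e.trans e2) (by norm_num))
      norm_num [expTrunc, Finset.sum_range_succ, Nat.factorial]
    · refine h.le_of_pow (p := 2) (c := 2) h.second (by norm_num)
        (mul_exp_le_pow_of_endpoints (by norm_num) (by norm_num) h2 h5 ?_ ?_) (by linarith)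
      · exact mul_exp_half_le_of_pow_le 149 100 2 (by norm_num) (by norm_num) (by norm_num)
          (by norm_num) (by norm_num)
      · exact mul_exp_half_le_of_pow_le 5 2 2 (by norm_num) (by norm_num) (by norm_num)
          (by norm_num) (by norm_num)
  · rcases le_total x 3.5 with h2 | h2
    · refine chi 2.5 3.5 (by norm_num) hl3 h2 (by norm_num) (by norm_num) ?_
      have e := le_exp_div_of_le_pow (a := 13) (b := 5) (C := 13.4) (by norm_num) (by norm_num)
      have e2 : Real.exp ((13 : ℕ) / (5 : ℕ)) ≤ Real.exp ((2.5 - 1) * (3.5 / 2)) :=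
        Real.exp_le_exp.2 (by norm_num)
      refine le_trans ?_ (mul_le_mul_of_nonneg_left (e.trans e2) (by norm_num))
      norm_num [expTrunc, Finset.sum_range_succ, Nat.factorial]
    · refine h.le_of_pow (p := 3) (c := 7.445) h.third (by norm_num)
        (mul_exp_le_pow_of_endpoints (by norm_num) (by norm_num) h2 h5 ?_ ?_) (by
          have := cubicMoment_mono h.one_le hl
          norm_num [cubicMoment] at this ⊢
          linarith)
      · exact mul_exp_half_le_of_pow_le 7 4 3 (by norm_num) (by norm_num) (by norm_num)
          (by norm_num) (by norm_num)
      · exact mul_exp_half_le_of_pow_le 5 2 3 (by norm_num) (by norm_num) (by norm_num)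
          (by norm_num) (by norm_num)

/-- In dimension four the second moment suffices on `[2.76, 5]` for `l ≤ 3.32`; larger `l` are
cut into intervals as in dimension three. -/
lemma le_dim_four (h : TailMoments ρ l x) (hl : l ≤ 4)
    (hc : ρ ≤ Real.exp (-(l * x / 2)) * expTrunc 8 (l * x / 2)) :
    ρ ≤ 4 * Real.exp (-(x / 2)) := by
  have hx := h.pos
  have chi : ∀ l₀ w : ℝ, 1 ≤ l₀ → l₀ ≤ l → x ≤ w → l₀ * w / 2 ≤ 6.1125 → l₀ ≤ 3.75 →
      expTrunc 8 (l₀ * w / 2) ≤ 4 * Real.exp ((l₀ - 1) * (w / 2)) →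
      ρ ≤ 4 * Real.exp (-(x / 2)) := by
    intro l₀ w h1 h2 h3 h4 h5 h6
    have e : ∀ z, expTrunc 8 z = expTrunc 7 z + z ^ 7 / 5040 := fun z => by
      simp [expTrunc, Finset.sum_range_succ _ 7, Nat.factorial]
    refine hc.trans (exp_neg_mul_le_of_endpoint (hasDerivAt_expTrunc 7) h1 h2 hx.le h3
      (fun z hz => ?_) (fun z hz hz2 => ?_) h6)
    · rw [e]
      have : 0 < z ^ 7 := by positivity
      linarith
    · have hz3 : z ≤ 6.1125 := hz2.trans h4
      have b : ∀ k : ℕ, z ^ (k + 1) ≤ 6.1125 * z ^ k := fun k => by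
        rw [pow_succ']
        gcongr
      suffices hs : 3.75 * (z ^ 7 / 5040) ≤ expTrunc 8 z by
        have h7 : l₀ * (z ^ 7 / 5040) ≤ 3.75 * (z ^ 7 / 5040) := by gcongr
        rw [e] at hs ⊢
        linarith
      simp only [expTrunc, Finset.sum_range_succ, Finset.sum_range_zero, Nat.factorial]
      have a2 : 0 < z ^ 2 := by positivity
      have a3 : 0 < z ^ 3 := by positivity
      have a4 : 0 < z ^ 4 := by positivity
      have b4 := b 4
      have b5 := b 5
      have b6 := b 6
      push_cast
      norm_num at b4 b5 b6 ⊢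
      linarith
  rcases le_total 5 x with h5 | h5
  · exact h.le_of_five_le (by norm_num) hl h5
  rcases le_total x 2.76 with h1 | h1
  · exact h.le_of_small (exp_half_le_of_pow_le 69 50 (by norm_num) (by norm_num) (by norm_num)
      (by norm_num)) h1
  rcases le_total l 3.32 with hl1 | hl1
  · refine h.le_of_pow (p := 2) (c := 1.91) h.second (by norm_num)
      (mul_exp_le_pow_of_endpoints (by norm_num) (by norm_num) h1 h5 ?_ ?_) (by linarith)
    · exact mul_exp_half_le_of_pow_le 69 50 2 (by norm_num) (by norm_num) (by norm_num)
        (by norm_num) (by norm_num)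
    · exact mul_exp_half_le_of_pow_le 5 2 2 (by norm_num) (by norm_num) (by norm_num)
        (by norm_num) (by norm_num)
  rcases le_total l 3.5 with hl2 | hl2
  · rcases le_total x 2.98 with h2 | h2
    · refine chi 3.32 2.98 (by norm_num) hl1 h2 (by norm_num) (by norm_num) ?_
      have e := le_exp_div_of_le_pow (a := 86) (b := 25) (C := 31.1) (by norm_num) (by norm_num)
      have e2 : Real.exp ((86 : ℕ) / (25 : ℕ)) ≤ Real.exp ((3.32 - 1) * (2.98 / 2)) :=
        Real.exp_le_exp.2 (by norm_num)
      refine le_trans ?_ (mul_le_mul_of_nonneg_left (e.trans e2) (by norm_num))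
      norm_num [expTrunc, Finset.sum_range_succ, Nat.factorial]
    · refine h.le_of_pow (p := 2) (c := 2) h.second (by norm_num)
        (mul_exp_le_pow_of_endpoints (by norm_num) (by norm_num) h2 h5 ?_ ?_) (by linarith)
      · exact mul_exp_half_le_of_pow_le 149 100 2 (by norm_num) (by norm_num) (by norm_num)
          (by norm_num) (by norm_num)
      · exact mul_exp_half_le_of_pow_le 5 2 2 (by norm_num) (by norm_num) (by norm_num)
          (by norm_num) (by norm_num)
  rcases le_total l 3.75 with hl3 | hl3
  · rcases le_total x 3.15 with h2 | h2
    · refine chi 3.5 3.15 (by norm_num) hl2 h2 (by norm_num) (by norm_num) ?_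
      have e := le_exp_div_of_le_pow (a := 98) (b := 25) (C := 50.3) (by norm_num) (by norm_num)
      have e2 : Real.exp ((98 : ℕ) / (25 : ℕ)) ≤ Real.exp ((3.5 - 1) * (3.15 / 2)) :=
        Real.exp_le_exp.2 (by norm_num)
      refine le_trans ?_ (mul_le_mul_of_nonneg_left (e.trans e2) (by norm_num))
      norm_num [expTrunc, Finset.sum_range_succ, Nat.factorial]
    · refine h.le_of_pow (p := 3) (c := 6.46) h.third (by norm_num)
        (mul_exp_le_pow_of_endpoints (by norm_num) (by norm_num) h2 h5 ?_ ?_) (by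
          have := cubicMoment_mono h.one_le hl3
          norm_num [cubicMoment] at this ⊢
          linarith)
      · exact mul_exp_half_le_of_pow_le 63 40 3 (by norm_num) (by norm_num) (by norm_num)
          (by norm_num) (by norm_num)
      · exact mul_exp_half_le_of_pow_le 5 2 3 (by norm_num) (by norm_num) (by norm_num)
          (by norm_num) (by norm_num)
  · rcases le_total x 3.26 with h2 | h2
    · refine chi 3.75 3.26 (by norm_num) hl3 h2 (by norm_num) (by norm_num) ?_
      have e := le_exp_div_of_le_pow (a := 89) (b := 20) (C := 84) (by norm_num) (by norm_num)
      have e2 : Real.exp ((89 : ℕ) / (20 : ℕ)) ≤ Real.exp ((3.75 - 1) * (3.26 / 2)) :=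
        Real.exp_le_exp.2 (by norm_num)
      refine le_trans ?_ (mul_le_mul_of_nonneg_left (e.trans e2) (by norm_num))
      norm_num [expTrunc, Finset.sum_range_succ, Nat.factorial]
    · refine h.le_of_pow (p := 3) (c := 6.75) h.third (by norm_num)
        (mul_exp_le_pow_of_endpoints (by norm_num) (by norm_num) h2 h5 ?_ ?_) (by
          have := cubicMoment_mono h.one_le hl
          norm_num [cubicMoment] at this ⊢
          linarith)
      · exact mul_exp_half_le_of_pow_le 163 100 3 (by norm_num) (by norm_num) (by norm_num)
          (by norm_num) (by norm_num)
      · exact mul_exp_half_le_of_pow_le 5 2 3 (by norm_num) (by norm_num) (by norm_num)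
          (by norm_num) (by norm_num)

end TailMoments

end Numerics

/-! ### The law of the random matrix and the tail bound -/

section Law

/-- The coordinates of independent standard Gaussian vectors are independent standard Gaussian
variables. -/
lemma map_eval_multivariateGaussian_pi (ι κ : Type*) [Fintype ι] [Fintype κ] [DecidableEq ι] :
    (Measure.pi fun _ : κ => multivariateGaussian 0 (1 : Matrix ι ι ℝ)).map
      (fun y (p : ι × κ) => (y p.2).ofLp p.1) = gaussPi (ι × κ) := by
  have hm : Measurable fun (y : κ → EuclideanSpace ℝ ι) (p : ι × κ) => (y p.2).ofLp p.1 := by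
    fun_prop
  refine (Measure.pi_eq fun s hs => ?_).symm
  rw [Measure.map_apply hm (MeasurableSet.univ_pi hs)]
  have e : (fun (y : κ → EuclideanSpace ℝ ι) (p : ι × κ) => (y p.2).ofLp p.1) ⁻¹' Set.univ.pi s
      = Set.univ.pi fun i => WithLp.ofLp ⁻¹' Set.univ.pi fun l => s (l, i) := by
    ext y
    simp only [Set.mem_preimage, Set.mem_univ_pi, Prod.forall]
    exact forall_comm
  rw [e, Measure.pi_pi, Fintype.prod_prod_type, Finset.prod_comm]
  refine Finset.prod_congr rfl fun i _ => ?_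
  have hs' : MeasurableSet (Set.univ.pi fun l => s (l, i)) := MeasurableSet.univ_pi fun l => hs _
  have e2 : (WithLp.toLp 2 : (ι → ℝ) → EuclideanSpace ℝ ι) ⁻¹'
      (WithLp.ofLp ⁻¹' Set.univ.pi fun l => s (l, i)) = Set.univ.pi fun l => s (l, i) := rfl
  rw [multivariateGaussian_zero_one, ← map_pi_eq_stdGaussian,
    Measure.map_apply (WithLp.measurable_toLp 2 _) ((WithLp.measurable_ofLp 2 _) hs'), e2,
    Measure.pi_pi]

variable {n m q : ℕ} (A : Matrix (Fin q) (Fin m) ℝ) (b : Fin n → EuclideanSpace ℝ (Fin q))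

lemma sumOuter_eq_gaussMatrix (x : Fin n → EuclideanSpace ℝ (Fin m)) :
    sumOuter A b x = gaussMatrix A (Matrix.of fun i => (b i).ofLp)
      (fun p : Fin m × Fin n => (x p.2).ofLp p.1) := by
  ext j k
  simp only [sumOuter, gaussMatrix, Matrix.sum_apply, Matrix.vecMulVec_apply, Matrix.mul_apply,
    Matrix.mulVec, dotProduct, Matrix.of_apply]

lemma sum_vecMulVec_eq :
    ∑ i, Matrix.vecMulVec (b i).ofLp (b i).ofLp
      = (Matrix.of fun i => (b i).ofLp)ᵀ * Matrix.of fun i => (b i).ofLp := by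
  ext j k
  simp [Matrix.sum_apply, Matrix.vecMulVec_apply, Matrix.mul_apply]

lemma sum_norm_sq_eq_trace :
    ∑ i, ‖b i‖ ^ 2 = ((Matrix.of fun i => (b i).ofLp)ᵀ * Matrix.of fun i => (b i).ofLp).trace := by
  rw [Matrix.trace_mul_comm, trace_mul_transpose_eq_sum, Fintype.sum_prod_type]
  exact Finset.sum_congr rfl fun i _ => EuclideanSpace.real_norm_sq_eq _

lemma measureReal_sumOuter_tail {Ω : Type*} [MeasurableSpace Ω] {P : Measure Ω}
    {ε : Fin n → Ω → EuclideanSpace ℝ (Fin m)}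
    (hlaw : ∀ i, HasLaw (ε i) (multivariateGaussian 0 (1 : Matrix (Fin m) (Fin m) ℝ)) P)
    (hindep : iIndepFun ε P) (t : ℝ) :
    P.real {ω | t ≤ ‖sumOuter A b (fun i => ε i ω)‖}
      = gaussTail A (Matrix.of fun i => (b i).ofLp) t := by
  have hae : AEMeasurable (fun ω i => ε i ω) P :=
    aemeasurable_pi_lambda _ fun i => (hlaw i).aemeasurable
  have hm : Measurable fun (y : Fin n → EuclideanSpace ℝ (Fin m)) (p : Fin m × Fin n) =>
      (y p.2).ofLp p.1 := by fun_prop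
  have h := hindep.map_fun_eq_pi_map fun i => (hlaw i).aemeasurable
  simp_rw [fun i => (hlaw i).map_eq] at h
  have hc : Continuous fun x => gaussMatrix A (Matrix.of fun i => (b i).ofLp) x := by
    unfold gaussMatrix
    fun_prop
  have hs : MeasurableSet {x : Fin m × Fin n → ℝ |
      t ≤ ‖gaussMatrix A (Matrix.of fun i => (b i).ofLp) x‖} :=
    (isClosed_le continuous_const hc.norm).measurableSet
  rw [gaussTail, ← map_eval_multivariateGaussian_pi, map_measureReal_apply hm hs, ← h,
    measureReal_def, measureReal_def, Measure.map_apply_of_aemeasurable hae (hm hs)]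
  congr 2
  ext ω
  simp only [Set.mem_ofPred_eq, Set.mem_preimage, sumOuter_eq_gaussMatrix]

end Law

section Main

lemma norm_le_trace_of_eq_mul_transpose {r m : Type*} [Fintype r] [Fintype m] [DecidableEq r]
    [DecidableEq m] (M : Matrix r m ℝ) : ‖M * Mᵀ‖ ≤ (M * Mᵀ).trace := by
  simpa using (posSemidef_mul_transpose M).norm_pow_le_trace_pow one_ne_zero

/-- The tail bound for `A X B` with `X` a matrix of independent standard Gaussian entries. -/
theorem gaussTail_le {m n : Type*} [Fintype m] [Fintype n] [DecidableEq m] [DecidableEq n]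
    {q : ℕ} (A : Matrix (Fin q) m ℝ) (B : Matrix n (Fin q) ℝ) {L : ℝ}
    (hL : L = max ((A * Aᵀ).trace * ‖Bᵀ * B‖) ((Bᵀ * B).trace * ‖A * Aᵀ‖)) (hL0 : 0 < L)
    {t : ℝ} (ht : 0 ≤ t) :
    gaussTail A B t ≤ q * Real.exp (-(t ^ 2) / (2 * L)) := by
  have hA : (A * Aᵀ).trace * ‖Bᵀ * B‖ ≤ L := hL ▸ le_max_left _ _
  have hB : (Bᵀ * B).trace * ‖A * Aᵀ‖ ≤ L := hL ▸ le_max_right _ _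
  have hAt := trace_le_card_mul_norm (A * Aᵀ)
  have hBt := trace_le_card_mul_norm (Bᵀ * B)
  rw [Fintype.card_fin] at hAt hBt
  obtain ⟨v, hv⟩ : ∃ v, v = ‖A * Aᵀ‖ * ‖Bᵀ * B‖ := ⟨_, rfl⟩
  have hLq : L ≤ q * v := by
    rw [hL, hv]
    refine max_le ?_ ?_
    · calc _ ≤ q * ‖A * Aᵀ‖ * ‖Bᵀ * B‖ := by gcongr
        _ = _ := by ring
    · calc _ ≤ q * ‖Bᵀ * B‖ * ‖A * Aᵀ‖ := by gcongr
        _ = _ := by ring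
  have hqv : 0 < q * v := hL0.trans_le hLq
  have hv0 : 0 < v := pos_of_mul_pos_right hqv (Nat.cast_nonneg q)
  have hq0 : 0 < q := by
    rcases Nat.eq_zero_or_pos q with h | h
    · simp [h] at hqv
    · exact h
  have hvL : v ≤ L := by
    refine le_trans ?_ hA
    rw [hv]
    gcongr
    exact norm_le_trace_of_eq_mul_transpose A
  have hl1 : 1 ≤ L / v := (one_le_div hv0).2 hvL
  have hlq : L / v ≤ q := (div_le_iff₀ hv0).2 hLq
  have hone : gaussTail A B t ≤ 1 := measureReal_le_one
  rcases ht.eq_or_lt with rfl | ht0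
  · refine hone.trans ?_
    simp
    omega
  obtain ⟨h1, h2, h3⟩ := gaussTail_moment_bounds hv hv0 hvL hA hB ht
  have H : TailMoments (gaussTail A B t) (L / v) (t ^ 2 / L) :=
    ⟨hone, hl1, by positivity, h1, h2, h3⟩
  have hexp : -(t ^ 2) / (2 * L) = -(t ^ 2 / L / 2) := by
    field_simp
  rw [hexp]
  -- The chi-squared comparison, needed for `q ≤ 4` only.
  have hdom := gaussTail_le_stdGaussian A B hv t
  have hset : {x : EuclideanSpace ℝ (Fin q × Fin q) | t ≤ √v * ‖x‖} = {x | t / √v ≤ ‖x‖} := by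
    ext x
    simp only [Set.mem_ofPred_eq]
    rw [div_le_iff₀' (Real.sqrt_pos.2 hv0)]
  have hr : 0 ≤ t / √v := by positivity
  have hz : (t / √v) ^ 2 / 2 = L / v * (t ^ 2 / L) / 2 := by
    rw [div_pow, Real.sq_sqrt hv0.le]
    field_simp
  have hdim : Module.finrank ℝ (EuclideanSpace ℝ (Fin q × Fin q)) = q * q := by simp
  rw [hset] at hdom
  rcases le_or_gt 5 q with hq5 | hq5
  · exact H.le_of_five_le_dim (by exact_mod_cast hq5) hlq
  have hq4 : q ≤ 4 := by omega
  clear hL hA hB hLq hqv hAt hBt h1 h2 h3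
  interval_cases q
  · have := stdGaussian_norm_tail_one (hdim.trans rfl) hr
    rw [hz] at this
    simpa using H.le_dim_one (hdom.trans this)
  · have := stdGaussian_norm_tail_even (k := 1) (hdim.trans rfl) hr
    rw [hz] at this
    exact_mod_cast H.le_dim_two (by exact_mod_cast hlq) (hdom.trans this.le)
  · have := stdGaussian_norm_tail_nine (hdim.trans rfl) hr
    rw [hz] at this
    refine mod_cast H.le_dim_three (by exact_mod_cast hlq) (hdom.trans (this.trans_eq ?_))
    simp only [expTrunc, Finset.sum_range_succ _ 4, Nat.factorial]
    push_cast
    ring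
  · have := stdGaussian_norm_tail_even (k := 7) (hdim.trans rfl) hr
    rw [hz] at this
    exact_mod_cast H.le_dim_four (by exact_mod_cast hlq) (hdom.trans this.le)

theorem mainTheorem3 {Ω : Type*} [MeasurableSpace Ω] (P : Measure Ω) [IsProbabilityMeasure P]
    (n m q : ℕ) (A : Matrix (Fin q) (Fin m) ℝ) (b : Fin n → EuclideanSpace ℝ (Fin q))
    (ε : Fin n → Ω → EuclideanSpace ℝ (Fin m))
    (hlaw : ∀ i, HasLaw (ε i) (multivariateGaussian 0 (1 : Matrix (Fin m) (Fin m) ℝ)) P)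
    (hindep : iIndepFun ε P) :
    (0 < varianceParam A b → ∀ t : ℝ, 0 ≤ t →
      P.real {ω | t ≤ ‖sumOuter A b (fun i => ε i ω)‖} ≤
        (max m q : ℝ) * Real.exp (-(t ^ 2) / (2 * varianceParam A b))) ∧
    (varianceParam A b = 0 → ∀ᵐ ω ∂P, sumOuter A b (fun i => ε i ω) = 0) := by
  set B : Matrix (Fin n) (Fin q) ℝ := Matrix.of fun i => (b i).ofLp with hB
  have hL : varianceParam A b
      = max ((A * Aᵀ).trace * ‖Bᵀ * B‖) ((Bᵀ * B).trace * ‖A * Aᵀ‖) := by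
    rw [varianceParam, sum_vecMulVec_eq, sum_norm_sq_eq_trace, Matrix.trace_mul_comm Aᵀ A]
  refine ⟨fun hL0 t ht => ?_, fun hL0 => Filter.Eventually.of_forall fun ω => ?_⟩
  · rw [measureReal_sumOuter_tail A b hlaw hindep]
    exact (gaussTail_le A B hL hL0 ht).trans
      (mul_le_mul_of_nonneg_right (le_max_right _ _) (Real.exp_pos _).le)
  · rw [sumOuter_eq_gaussMatrix, ← hB, gaussMatrix]
    have h1 : ‖A * Aᵀ‖ * ‖Bᵀ * B‖ ≤ 0 := by
      rw [← hL0, hL]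
      refine le_max_of_le_left ?_
      gcongr
      exact norm_le_trace_of_eq_mul_transpose A
    have h2 : ‖A * Aᵀ‖ * ‖Bᵀ * B‖ = 0 := h1.antisymm (by positivity)
    rcases mul_eq_zero.1 h2 with h | h
    · have : A = 0 := Matrix.self_mul_conjTranspose_eq_zero.1
          (by simpa [Matrix.conjTranspose_eq_transpose_of_trivial] using h)
      simp [this]
    · have : B = 0 := Matrix.conjTranspose_mul_self_eq_zero.1
          (by simpa [Matrix.conjTranspose_eq_transpose_of_trivial] using h)
      simp [this]

end Main
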